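/- Let $\mathcal R=\mathbb C[x,y]$ and $[f,g]=\frac{\partial f}{\partial x}\frac{\partial g}{\partial y}-\frac{\partial g}{\partial x}\frac{\partial f}{\partial y}$. For $f\in\mathcal R$ let $N^0(f)\subset\mathbb R^2$ be the convex hull of $\operatorname{supp}(f)\cup\{(0,0)\}$. For nonnegative integers $m,n$ let $\operatorname{Rect}_{m,n}$ be the convex hull of $(0,0),(m,0),(m,n),(0,n)$. For positive integers $m,n$ let $R_{m,n}$ be the set of $f\in\mathcal R$ with $N^0(f)=\operatorname{Rect}_{m,n}$ in which $x^my^n$ has coefficient $1$, and let $\overline R_{m,n}$ be the set of $f\in\mathcal R$ with $N^0(f)\subseteq\operatorname{Rect}_{m,n}$ in which $x^my^n$ has nonzero coefficient. Let $\mathbb T\subset\mathbb C[z]$ be the set of monic polynomials of degree $k\ge 1$ whose coefficient of $z^{k-1}$ is $0$. A polynomial $f\in\mathcal R$ is principal if $f=\alpha(W)$ with $\alpha\in\mathbb T$, $W\in\mathcal R$ implies $W=f$. Let $a,b,m,n$ be positive integers with $2\le a<b$, $\gcd(a,b)=1$, $a\mid m$ and $a\mid n$, and let $F\in R_{m,n}$.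 Put $\mathcal N''=\operatorname{Rect}_{m/a,n/a}+\frac{a-1}{a}(m,n)$. There is a unique $Q\in R_{m/a,n/a}$ with $\operatorname{supp}(F-Q^a)\subseteq N^0(F)\setminus\mathcal N''$, and a unique pair $(\beta,W_F)\in\mathbb T\times\mathcal R$ such that, with $\delta=\deg\beta$, $\delta$ divides $m/a$ and $n/a$, $W_F$ is principal, $W_F\in R_{m/(a\delta),n/(a\delta)}$ and $\operatorname{supp}(F-\beta(W_F)^a)\subseteq N^0(F)\setminus\mathcal N''$. The innermost polynomial of $F$ is $$Z=F-Q^a-\sum_{j=0}^{(a-1)\delta-1}e_jW_F^j,$$ where the $e_j\in\mathbb C$ are uniquely determined by the condition that none of the monomials $x^{jm/(a\delta)}y^{jn/(a\delta)}$, $0\le j\le(a-1)\delta-1$, occurs in $Z$. The EN vertex of a convex polygon is the higher one of its (one or two) rightmost vertices, and the NE vertex is the rightmost one of its (one or two) uppermost vertices. Theorem. Assume in addition that $m\le n$, $G\in R_{bm/a,bn/a}$ and $[F,G]\in\mathbb C$. Then either $Z=0$, or there is a lattice point $(m',n')$ with positive coordinates such that (1) $Z\in\overline R_{m',n'}$;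 (2) $(m',n')$ lies in $$\Big\{(x,y)\in\mathbb R^2:\ 0\le y<\tfrac{a-1}{a}n,\ \ \mathfrak m\big(x-\tfrac{a}{a+b}\big)+\tfrac{a}{a+b}\le y\le\tfrac nm x\Big\},$$ where $\mathfrak m=\big(n-\frac{a}{a+b}\big)/\big(m-\frac{a}{a+b}\big)$ is the slope of the line through $(m,n)$ and $C=\big(\frac{a}{a+b},\frac{a}{a+b}\big)$. In particular, the NE and EN vertices of $N^0(Z)$ coincide. -/

import Mathlib

noncomputable section

namespace PlaneJac

open MvPolynomial

/-- The ring `ℂ[x, y]`; the variable `0` is `x` and the variable `1` is `y`. -/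
abbrev Poly : Type := MvPolynomial (Fin 2) ℂ

/-- The exponent vector of the monomial `x ^ i * y ^ j`. -/
def expo (i j : ℕ) : Fin 2 →₀ ℕ := Finsupp.single 0 i + Finsupp.single 1 j

/-- The Jacobian determinant `[f, g]`. -/
def jacobian (f g : Poly) : Poly :=
  pderiv 0 f * pderiv 1 g - pderiv 0 g * pderiv 1 f

/-- The support of `f`, as a set of points of the real plane. -/
def supp (f : Poly) : Set (ℝ × ℝ) :=
  {p | ∃ i j : ℕ, coeff (expo i j) f ≠ 0 ∧ p = ((i : ℝ), (j : ℝ))}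

/-- The augmented Newton polygon `N⁰(f)`. -/
def newton0 (f : Poly) : Set (ℝ × ℝ) :=
  convexHull ℝ (supp f ∪ {((0 : ℝ), (0 : ℝ))})

/-- The rectangle with vertices `(0,0)`, `(m,0)`, `(m,n)`, `(0,n)`. -/
def rect (m n : ℕ) : Set (ℝ × ℝ) :=
  convexHull ℝ {((0 : ℝ), (0 : ℝ)), ((m : ℝ), (0 : ℝ)), ((m : ℝ), (n : ℝ)), ((0 : ℝ), (n : ℝ))}

/-- The quadruples `(a, b, m, n)` of positive integers with `a ∣ m`, `a ∣ n`, `gcd (a, b) = 1`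
and `2 ≤ a < b`. -/
def Admissible (a b m n : ℕ) : Prop :=
  0 < a ∧ 0 < b ∧ 0 < m ∧ 0 < n ∧ a ∣ m ∧ a ∣ n ∧ Nat.gcd a b = 1 ∧ 2 ≤ a ∧ a < b

/-- The set `R_{m,n}`. -/
def R (m n : ℕ) : Set Poly :=
  {f | newton0 f = rect m n ∧ coeff (expo m n) f = 1}

/-- The set `R̄_{m,n}`. -/
def Rbar (m n : ℕ) : Set Poly :=
  {f | newton0 f ⊆ rect m n ∧ coeff (expo m n) f ≠ 0}

/-- The monic one-variable polynomials of positive degree whose subleading coefficient is `0`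
(the Tschirnhausen polynomials). -/
def tschirnhausen : Set (Polynomial ℂ) :=
  {α | α.Monic ∧ 0 < α.natDegree ∧ α.coeff (α.natDegree - 1) = 0}

/-- The set `𝒲(f)` of all `W` with `f = α(W)` for a Tschirnhausen polynomial `α`. -/
def outerRoots (f : Poly) : Set Poly :=
  {W | ∃ α ∈ tschirnhausen, f = Polynomial.aeval W α}

/-- `f` is a principal polynomial. -/
def IsPrincipal (f : Poly) : Prop := outerRoots f = {f}

/-- The rectangle `𝒩''`: the rectangle of size `m / a` by `n / a`, translated by
`((a - 1) / a) • (m, n)`. -/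
def innerCorner (a m n : ℕ) : Set (ℝ × ℝ) :=
  (fun p => (((a : ℝ) - 1) / a) • ((m : ℝ), (n : ℝ)) + p) '' rect (m / a) (n / a)

/-- `Q` is the pre-generator for the pair `(F, a)`, where `F ∈ R_{m,n}`. -/
def IsPreGenerator (a m n : ℕ) (F Q : Poly) : Prop :=
  Q ∈ R (m / a) (n / a) ∧ supp (F - Q ^ a) ⊆ newton0 F \ innerCorner a m n

/-- `W` is the generator `W_F` for `F ∈ R_{m,n}`, with accompanying polynomial `β` of degree
`δ`. -/
def IsGenerator (a m n : ℕ) (F : Poly) (δ : ℕ) (β : Polynomial ℂ) (W : Poly) : Prop :=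
  δ ∣ m / a ∧ δ ∣ n / a ∧
  IsPrincipal W ∧ W ∈ R (m / (a * δ)) (n / (a * δ)) ∧
  β ∈ tschirnhausen ∧ β.natDegree = δ ∧
  supp (F - (Polynomial.aeval W β) ^ a) ⊆ newton0 F \ innerCorner a m n

/-- `Z` is the innermost polynomial of `F ∈ R_{m,n}`:
`Z = F - Q ^ a - ∑ e_j W_F ^ j` over `0 ≤ j ≤ (a - 1) δ - 1`, the `e_j` being such that no monomial
`x ^ (j m / (a δ)) y ^ (j n / (a δ))` with `j` in that range occurs in `Z`. -/
def IsInnermost (a m n : ℕ) (F Z : Poly) : Prop :=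
  ∃ (Q : Poly) (δ : ℕ) (β : Polynomial ℂ) (W : Poly) (e : ℕ → ℂ),
    IsPreGenerator a m n F Q ∧ IsGenerator a m n F δ β W ∧
    Z = F - Q ^ a - ∑ j ∈ Finset.range ((a - 1) * δ), C (e j) * W ^ j ∧
    ∀ j < (a - 1) * δ, coeff (expo (j * m / (a * δ)) (j * n / (a * δ))) Z = 0

/-- `v` is the EN vertex of the convex polygon `P`: the higher one of its rightmost vertices. -/
def IsENVertex (P : Set (ℝ × ℝ)) (v : ℝ × ℝ) : Prop :=
  v ∈ P.extremePoints ℝ ∧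
    ∀ q ∈ P.extremePoints ℝ, q.1 < v.1 ∨ (q.1 = v.1 ∧ q.2 ≤ v.2)

/-- `v` is the NE vertex of the convex polygon `P`: the rightmost one of its uppermost
vertices. -/
def IsNEVertex (P : Set (ℝ × ℝ)) (v : ℝ × ℝ) : Prop :=
  v ∈ P.extremePoints ℝ ∧
    ∀ q ∈ P.extremePoints ℝ, q.2 < v.2 ∨ (q.2 = v.2 ∧ q.1 ≤ v.1)

/-- The common coordinate `a / (a + b)` of the point `C`. -/
def cpt (a b : ℕ) : ℝ := (a : ℝ) / ((a : ℝ) + b)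

/-- The slope of the line through `(m, n)` and `C`. -/
def slopeC (a b m n : ℕ) : ℝ := ((n : ℝ) - cpt a b) / ((m : ℝ) - cpt a b)

/-- The narrow region. -/
def narrowRegion (a b m n : ℕ) : Set (ℝ × ℝ) :=
  {p | 0 ≤ p.2 ∧ p.2 < (((a : ℝ) - 1) / a) * n ∧
    slopeC a b m n * (p.1 - cpt a b) + cpt a b ≤ p.2 ∧ p.2 ≤ ((n : ℝ) / m) * p.1}

end PlaneJac

end

/-!
Write `F = P(W) + Z`, where `W = W_F` and `P = β ^ a + ∑ e_j z ^ j` is monic of degree `d = a δ`; this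
uses `Q = β(W)`, which holds because the upper right corner of `Q ^ a` determines `Q`
(`PlaneJac.eq_of_pow_sub_pow`). Let `(m₁, n₁)` be the EN vertex of `Z`, and put `c = a / (a + b)`.

The heart of the matter is `PlaneJac.false_of_vertex`: if `n₁ < (a - 1) n / a`, then `(m₁, n₁)` cannot
lie both below the diagonal of the rectangle and below the line through `(m, n)` and `C = (c, c)`. To
see this, look at `F`, `G`, `W`, `Z` near the points at infinity with `x = ∞`, in the ring
`ℂ[y][t, t⁻¹]` with `x = t`, where the leading coefficients in `t` are polynomials in `y`. Choose a
root of the leading coefficient of `W` at which that of `Z` vanishes to at most average order, move it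
to `y = 0`, and zoom in by `t ↦ t ^ k`, `y ↦ t ^ (-θ) y` with the least slope `θ / k` at which `W` or `Z`
acquires a new leading coefficient, or at which `Z` reaches the degree of `P(W)`. This is a step of the
Newton-Puiseux algorithm for `W`, with averaging over the roots. The averaging preserves the ratio of
the orders of `Z` and `P(W)` being less than `(a - 1) / a`, and the two position conditions
(`PlaneJac.Chart.Stage.shift`). The position conditions imply that the bracket of the leading terms of
`F` and `G`, whose degree would be larger than that of the monomial `[F, G]`, vanishes, so that their
divisors are in proportion `a : b` (`PlaneJac.Chart.Stage.rootMultiplicity_top`), and that the degrees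
of `F` and `G` stay in this proportion (`PlaneJac.Chart.Stage.subst`). The process ends with `Z` reaching
the degree of `P(W)` (`PlaneJac.Chart.Stage.false_of_order`). There the leading coefficient of `F` is an
`a`-th power since `a` and `b` are coprime; it is the sum of the leading coefficient of `Z` and another
`a`-th power, which is impossible because two `a`-th powers of polynomials of degree `e` differ in
degree at least `(a - 1) e` (`PlaneJac.Chart.Stage.not_eq`).

Apply this to `(x, y)` and to `(y, x)`. As `Z` has no monomial in `𝒩''` and `m ≤ n`, it follows that
`n₁ < (a - 1) n / a`, that the EN vertex lies on or above the line through `C`, and that the NE vertex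
lies on or below the diagonal. The region between these lines is too narrow for a segment of negative
slope between two lattice points, so the vertices coincide (`PlaneJac.vertices_coincide`).
-/

noncomputable section

namespace PlaneJac

open Polynomial LaurentPolynomial

/-- The ring `ℂ[y][t, t⁻¹]`, in which the pair is examined near infinity: `t` is large and `y` is
bounded. -/
abbrev Chart : Type := LaurentPolynomial ℂ[X]

namespace Chart

theorem ext₂ {f g : Chart} (h : ∀ e q, (f.coeff e).coeff q = (g.coeff e).coeff q) : f = g := by
  ext e q
  exact h e q

theorem coeff_smul_apply' (c : ℂ) (f : Chart) (e : ℤ) : (c • f).coeff e = c • f.coeff e := rfl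

theorem induction₂ {p : Chart → Prop} (f : Chart) (h0 : p 0) (hadd : ∀ f g, p f → p g → p (f + g))
    (hm : ∀ n q c, p (AddMonoidAlgebra.single n (monomial q c))) : p f := by
  induction f using AddMonoidAlgebra.induction_linear with
  | zero => exact h0
  | add f g hf hg => exact hadd f g hf hg
  | single n a =>
    induction a using Polynomial.induction_on' with
    | add a b ha hb => rw [AddMonoidAlgebra.single_add]; exact hadd _ _ ha hb
    | monomial q c => exact hm n q c

/-! ### Degree in `t` and leading coefficient -/

/-- The degree of `f` in `t` is at most `e`; the leading coefficient, a polynomial in `y`, is then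
`f.coeff e`. -/
def DegLE (f : Chart) (e : ℤ) : Prop := ∀ n, e < n → f.coeff n = 0

theorem DegLE.mono {f : Chart} {d e : ℤ} (h : DegLE f d) (hde : d ≤ e) : DegLE f e :=
  fun n hn => h n (hde.trans_lt hn)

theorem DegLE.add {f g : Chart} {e : ℤ} (hf : DegLE f e) (hg : DegLE g e) : DegLE (f + g) e := by
  intro n hn
  simp [hf n hn, hg n hn]

theorem DegLE.smul {f : Chart} {e : ℤ} (hf : DegLE f e) (c : ℂ) : DegLE (c • f) e := by
  intro n hn
  rw [coeff_smul_apply', hf n hn, smul_zero]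

theorem degLE_zero (e : ℤ) : DegLE 0 e := fun _ _ => rfl

theorem DegLE.sum {ι : Type*} {s : Finset ι} {f : ι → Chart} {e : ℤ}
    (hf : ∀ i ∈ s, DegLE (f i) e) : DegLE (∑ i ∈ s, f i) e := by
  classical
  induction s using Finset.induction_on with
  | empty => simpa using degLE_zero e
  | insert i s hi ih =>
    rw [Finset.sum_insert hi]
    exact (hf i (by simp)).add (ih fun j hj => hf j (by simp [hj]))

theorem DegLE.mul {f g : Chart} {d e : ℤ} (hf : DegLE f d) (hg : DegLE g e) :
    DegLE (f * g) (d + e) := by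
  classical
  intro n hn
  by_contra hne
  have := AddMonoidAlgebra.support_coeff_mul_subset f g (Finsupp.mem_support_iff.2 hne)
  obtain ⟨i, hi, j, hj, rfl⟩ := Finset.mem_add.1 this
  have h1 : ¬ d < i := fun h => Finsupp.mem_support_iff.1 hi (hf i h)
  have h2 : ¬ e < j := fun h => Finsupp.mem_support_iff.1 hj (hg j h)
  omega

theorem DegLE.coeff_mul {f g : Chart} {d e : ℤ} (hf : DegLE f d) (hg : DegLE g e) :
    (f * g).coeff (d + e) = f.coeff d * g.coeff e := by
  apply AddMonoidAlgebra.coeff_mul_add_of_uniqueAdd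
  intro i j hi hj hij
  have h1 : ¬ d < i := fun h => Finsupp.mem_support_iff.1 hi (hf i h)
  have h2 : ¬ e < j := fun h => Finsupp.mem_support_iff.1 hj (hg j h)
  omega

theorem DegLE.pow {f : Chart} {d : ℤ} (hf : DegLE f d) (n : ℕ) : DegLE (f ^ n) (n * d) := by
  induction n with
  | zero =>
    intro k hk
    rw [pow_zero, ← T_zero, T_apply, if_neg]
    push_cast at hk
    omega
  | succ n ih =>
    rw [pow_succ]
    convert ih.mul hf using 1
    push_cast; ring

theorem DegLE.coeff_pow {f : Chart} {d : ℤ} (hf : DegLE f d) (n : ℕ) :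
    (f ^ n).coeff (n * d) = f.coeff d ^ n := by
  induction n with
  | zero => rw [pow_zero, ← T_zero, T_apply]; simp
  | succ n ih =>
    rw [pow_succ, pow_succ, ← ih, ← (hf.pow n).coeff_mul hf]
    congr 1
    push_cast; ring

/-- If `W` has positive degree in `t`, the leading term of `P(W)` is that of the leading power. -/
theorem aeval_leading {W : Chart} {p : ℤ} (hW : DegLE W p) (hp : 0 < p) {P : ℂ[X]} (hP : P.Monic) :
    DegLE (aeval W P) (P.natDegree * p) ∧
      (aeval W P).coeff (P.natDegree * p) = W.coeff p ^ P.natDegree := by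
  have hlow : DegLE (∑ i ∈ Finset.range P.natDegree, P.coeff i • W ^ i)
      (P.natDegree * p - 1) := by
    refine DegLE.sum fun i hi => ((hW.pow i).mono ?_).smul _
    have : (i : ℤ) + 1 ≤ P.natDegree := by exact_mod_cast Finset.mem_range.1 hi
    nlinarith
  have key : aeval W P =
      (∑ i ∈ Finset.range P.natDegree, P.coeff i • W ^ i) + W ^ P.natDegree := by
    rw [aeval_eq_sum_range, Finset.sum_range_succ, hP.coeff_natDegree, one_smul]
  refine ⟨key ▸ (hlow.mono (by omega)).add (hW.pow _), ?_⟩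
  rw [key, AddMonoidAlgebra.coeff_add, Finsupp.add_apply, hlow _ (by omega), zero_add,
    hW.coeff_pow]

/-! ### The bracket -/

/-- The Euler derivation `t ∂/∂t`. -/
def euler (f : Chart) : Chart :=
  .ofCoeff (Finsupp.onFinset f.coeff.support (fun n => (n : ℂ[X]) * f.coeff n)
    (fun _ hn => Finsupp.mem_support_iff.2 (right_ne_zero_of_mul hn)))

/-- The derivation `∂/∂y`. -/
def dY (f : Chart) : Chart := AddMonoidAlgebra.map (derivative (R := ℂ)).toAddMonoidHom f

@[simp] theorem coeff_euler (f : Chart) (n : ℤ) : (euler f).coeff n = n * f.coeff n := rfl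

@[simp] theorem coeff_dY (f : Chart) (n : ℤ) : (dY f).coeff n = derivative (f.coeff n) := rfl

/-- The Jacobian determinant with respect to `log t` and `y`. -/
def bracket (f g : Chart) : Chart := euler f * dY g - euler g * dY f

theorem DegLE.euler {f : Chart} {d : ℤ} (hf : DegLE f d) : DegLE (euler f) d := by
  intro n hn
  simp [hf n hn]

theorem DegLE.dY {f : Chart} {d : ℤ} (hf : DegLE f d) : DegLE (dY f) d := by
  intro n hn
  simp [hf n hn]

theorem coeff_bracket {f g : Chart} {d e : ℤ} (hf : DegLE f d) (hg : DegLE g e) :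
    (bracket f g).coeff (d + e) = (d : ℂ[X]) * f.coeff d * derivative (g.coeff e) -
      (e : ℂ[X]) * g.coeff e * derivative (f.coeff d) := by
  have h1 := hf.euler.coeff_mul hg.dY
  have h2 := hg.euler.coeff_mul hf.dY
  rw [add_comm e d] at h2
  simp only [bracket, AddMonoidAlgebra.coeff_sub, Finsupp.sub_apply, h1, h2, coeff_euler, coeff_dY]

/-! ### Changes of chart -/

/-- The substitution `y ↦ y + r`. -/
def shift (r : ℂ) : Chart →ₐ[ℂ] Chart := AddMonoidAlgebra.mapAlgHom ℤ (taylorAlgHom r)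

@[simp] theorem coeff_shift (r : ℂ) (f : Chart) (n : ℤ) :
    (shift r f).coeff n = taylor r (f.coeff n) := rfl

theorem bracket_shift (r : ℂ) (f g : Chart) :
    bracket (shift r f) (shift r g) = shift r (bracket f g) := by
  have h1 : ∀ f, euler (shift r f) = shift r (euler f) := by
    intro f
    ext1; ext1 n
    simp only [coeff_euler, coeff_shift, taylor_mul, ← Polynomial.C_eq_intCast, taylor_C]
  have h2 : ∀ f, dY (shift r f) = shift r (dY f) := by
    intro f
    ext1; ext1 n
    simp [taylor_apply, derivative_comp]
  simp only [bracket, h1, h2, map_sub, map_mul]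

/-- The invertible element `t ^ k`. -/
def unitT (k : ℤ) : Chartˣ :=
  ⟨T k, T (-k), by rw [← T_add]; simp, by rw [← T_add]; simp⟩

theorem unitT_zpow (k n : ℤ) : ((unitT k ^ n : Chartˣ) : Chart) = T (k * n) := by
  have h : ∀ n : ℕ, ((unitT k ^ n : Chartˣ) : Chart) = T (k * n) := by
    intro n
    rw [Units.val_pow_eq_pow_val]
    change T k ^ n = _
    rw [T_pow, mul_comm]
  have hinv : ∀ a b : ℤ, ∀ u : Chartˣ, (u : Chart) = T a → b = -a →
      ((u⁻¹ : Chartˣ) : Chart) = T b := by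
    rintro a b u hu rfl
    have : u⁻¹ = unitT (-a) := by
      apply inv_eq_of_mul_eq_one_right
      ext1
      change (u : Chart) * T (-a) = 1
      rw [hu, ← T_add]; simp
    rw [this]; rfl
  obtain ⟨m, rfl | rfl⟩ := n.eq_nat_or_neg
  · rw [zpow_natCast, h]
  · rw [zpow_neg, zpow_natCast]
    exact hinv _ _ _ (h m) (by ring)

/-- The substitution `t ↦ t ^ k`, `y ↦ t ^ (-θ) y`. -/
def subst (k θ : ℤ) : Chart →ₐ[ℂ] Chart :=
  { LaurentPolynomial.eval₂ (aeval (AddMonoidAlgebra.single (-θ) X : Chart) : ℂ[X] →ₐ[ℂ] Chart).toRingHom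
      (unitT k) with
    commutes' := by
      intro c
      change LaurentPolynomial.eval₂ _ _ (LaurentPolynomial.C (algebraMap ℂ ℂ[X] c)) = _
      rw [LaurentPolynomial.eval₂_C]
      exact AlgHom.commutes _ c }

theorem subst_single (k θ n : ℤ) (q : ℕ) (c : ℂ) :
    subst k θ (AddMonoidAlgebra.single n (monomial q c)) =
      AddMonoidAlgebra.single (k * n - θ * q) (monomial q c) := by
  rw [show (AddMonoidAlgebra.single n (monomial q c) : Chart) =
      LaurentPolynomial.C (monomial q c) * T n from
    single_eq_C_mul_T _ _]
  change LaurentPolynomial.eval₂ _ _ _ = _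
  rw [LaurentPolynomial.eval₂_C_mul_T, unitT_zpow]
  change aeval _ (monomial q c) * _ = _
  rw [aeval_monomial, AddMonoidAlgebra.single_pow]
  change AddMonoidAlgebra.single 0 (Polynomial.C c) * _ * AddMonoidAlgebra.single _ 1 = _
  rw [AddMonoidAlgebra.single_mul_single, AddMonoidAlgebra.single_mul_single, mul_one,
    C_mul_X_pow_eq_monomial]
  congr 1
  simp only [nsmul_eq_mul]
  ring

theorem coeff_subst {k : ℤ} (hk : k ≠ 0) (θ : ℤ) (f : Chart) (e : ℤ) (q : ℕ) :
    ((subst k θ f).coeff e).coeff q =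
      if k ∣ e + θ * q then (f.coeff ((e + θ * q) / k)).coeff q else 0 := by
  induction f using induction₂ with
  | h0 => simp
  | hadd f g hf hg =>
    rw [map_add, AddMonoidAlgebra.coeff_add, Finsupp.add_apply, Polynomial.coeff_add, hf, hg]
    split_ifs <;> simp
  | hm n q' c =>
    rw [subst_single, AddMonoidAlgebra.coeff_single, AddMonoidAlgebra.coeff_single,
      Finsupp.single_apply, Finsupp.single_apply]
    by_cases hq : q' = q
    · subst hq
      by_cases hd : k ∣ e + θ * q'
      · obtain ⟨i, hi⟩ := hd
        have h1 : (e + θ * q') / k = i := by rw [hi, Int.mul_ediv_cancel_left _ hk]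
        have h2 : k * n - θ * q' = e ↔ n = i := by
          constructor
          · intro h
            exact mul_left_cancel₀ hk (by linarith)
          · rintro rfl; linarith
        rw [if_pos (show k ∣ e + θ * q' from ⟨i, hi⟩), h1]
        simp only [h2]
      · have h2 : k * n - θ * q' ≠ e := fun h => hd ⟨n, by linarith⟩
        rw [if_neg hd, if_neg h2, Polynomial.coeff_zero]
    · have : ∀ (P : Prop) [Decidable P], (if P then (monomial q' c : ℂ[X]) else 0).coeff q = 0 := by
        intro P _
        split_ifs <;> simp [coeff_monomial, hq]
      rw [this, this, ite_self]

/-- The monomial `t ^ i y ^ q` becomes `t ^ (k i - θ q) y ^ q`. -/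
theorem coeff_subst_image {k : ℤ} (hk : k ≠ 0) (θ : ℤ) (f : Chart) (i : ℤ) (q : ℕ) :
    ((subst k θ f).coeff (k * i - θ * q)).coeff q = (f.coeff i).coeff q := by
  rw [coeff_subst hk, sub_add_cancel, if_pos (dvd_mul_right _ _), Int.mul_ediv_cancel_left _ hk]

theorem exists_of_coeff_subst_ne_zero {k : ℤ} (hk : k ≠ 0) {θ : ℤ} {f : Chart} {e : ℤ} {q : ℕ}
    (h : ((subst k θ f).coeff e).coeff q ≠ 0) :
    ∃ i, e = k * i - θ * q ∧ (f.coeff i).coeff q ≠ 0 := by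
  rw [coeff_subst hk] at h
  split_ifs at h with hd
  · obtain ⟨i, hi⟩ := hd
    rw [hi, Int.mul_ediv_cancel_left _ hk] at h
    exact ⟨i, by linarith, h⟩
  · exact absurd rfl h

theorem dY_subst {k : ℤ} (hk : k ≠ 0) (θ : ℤ) (f : Chart) :
    dY (subst k θ f) = T (-θ) * subst k θ (dY f) := by
  apply ext₂
  intro e q
  rw [coeff_dY, coeff_derivative, coeff_subst hk]
  have : (T (-θ) * subst k θ (dY f)).coeff e = (subst k θ (dY f)).coeff (e + θ) := by
    rw [T, AddMonoidAlgebra.coeff_single_mul_apply, one_mul]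
    congr 1
    ring
  rw [this, coeff_subst hk]
  have h2 : e + θ + θ * q = e + θ * ((q + 1 : ℕ) : ℤ) := by push_cast; ring
  rw [h2]
  split_ifs
  · rw [coeff_dY, coeff_derivative]
  · simp

theorem euler_subst {k : ℤ} (hk : k ≠ 0) (θ : ℤ) (f : Chart) :
    euler (subst k θ f) = (k : Chart) * subst k θ (euler f) -
      (θ : Chart) * subst k θ (LaurentPolynomial.C X * dY f) := by
  have hcast : ∀ (z e : ℤ) (q : ℕ) (g : Chart),
      (((z : Chart) * g).coeff e).coeff q = z * (g.coeff e).coeff q := by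
    intro z e q g
    rw [← zsmul_eq_mul, AddMonoidAlgebra.coeff_smul, Finsupp.smul_apply, Polynomial.coeff_smul,
      zsmul_eq_mul]
  apply ext₂
  intro e q
  rw [AddMonoidAlgebra.coeff_sub, Finsupp.sub_apply, Polynomial.coeff_sub, hcast, hcast,
    coeff_euler, ← Polynomial.C_eq_intCast, coeff_C_mul, coeff_subst hk, coeff_subst hk,
    coeff_subst hk]
  split_ifs with hd
  · obtain ⟨i, hi⟩ := hd
    rw [hi, Int.mul_ediv_cancel_left _ hk, coeff_euler, ← Polynomial.C_eq_intCast, coeff_C_mul]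
    have hX : ((LaurentPolynomial.C X * dY f).coeff i).coeff q = q * (f.coeff i).coeff q := by
      change ((AddMonoidAlgebra.single 0 X * dY f : Chart).coeff i).coeff q = _
      rw [AddMonoidAlgebra.coeff_single_zero_mul,
        coeff_dY]
      cases q with
      | zero => simp
      | succ q =>
        rw [coeff_X_mul, coeff_derivative]
        push_cast; ring
    rw [hX]
    have : (e : ℂ) = k * i - θ * q := by
      have : e = k * i - θ * q := by linarith
      rw [this]; push_cast; ring
    rw [this]
    ring
  · simp

theorem bracket_subst {k : ℤ} (hk : k ≠ 0) (θ : ℤ) (f g : Chart) :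
    bracket (subst k θ f) (subst k θ g) = (k : Chart) * T (-θ) * subst k θ (bracket f g) := by
  simp only [bracket, euler_subst hk, dY_subst hk, map_sub, map_mul]
  ring

end Chart

end PlaneJac

namespace PlaneJac

open Polynomial

/-! ### Polynomials in one variable -/

/-- If `g ^ α / f ^ β` has derivative zero, then `f` and `g` have proportional divisors. -/
theorem rootMultiplicity_of_log_derivative {f g : ℂ[X]} (hf : f ≠ 0) (hg : g ≠ 0) {α β : ℤ}
    (h : (α : ℂ[X]) * f * derivative g = (β : ℂ[X]) * g * derivative f) (r : ℂ) :
    α * g.rootMultiplicity r = β * f.rootMultiplicity r := by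
  obtain ⟨u, hu, hur⟩ := exists_eq_pow_rootMultiplicity_mul_and_not_dvd f hf r
  obtain ⟨v, hv, hvr⟩ := exists_eq_pow_rootMultiplicity_mul_and_not_dvd g hg r
  set i := f.rootMultiplicity r
  set j := g.rootMultiplicity r
  have hder : ∀ (n : ℕ) (s : ℂ[X]), (X - C r) * derivative ((X - C r) ^ n * s) =
      (X - C r) ^ n * ((n : ℂ[X]) * s + (X - C r) * derivative s) := by
    intro n s
    cases n with
    | zero => simp
    | succ n =>
      simp only [derivative_mul, derivative_pow, derivative_sub, derivative_X, derivative_C,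
        Nat.add_sub_cancel]
      simp only [map_natCast]
      ring
  have h1 := congrArg (fun q => (X - C r) * q) h
  have h2 : (X - C r) ^ (i + j) * ((α : ℂ[X]) * u * ((j : ℂ[X]) * v + (X - C r) * derivative v)) =
      (X - C r) ^ (i + j) * ((β : ℂ[X]) * v * ((i : ℂ[X]) * u + (X - C r) * derivative u)) := by
    have e1 := hder i u
    have e2 := hder j v
    rw [← hu] at e1
    rw [← hv] at e2
    calc _ = (α : ℂ[X]) * ((X - C r) ^ i * u) *
          ((X - C r) ^ j * ((j : ℂ[X]) * v + (X - C r) * derivative v)) := by ring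
      _ = (X - C r) * ((α : ℂ[X]) * f * derivative g) := by rw [← e2, ← hu]; ring
      _ = (X - C r) * ((β : ℂ[X]) * g * derivative f) := h1
      _ = (β : ℂ[X]) * ((X - C r) ^ j * v) *
          ((X - C r) ^ i * ((i : ℂ[X]) * u + (X - C r) * derivative u)) := by
        rw [← e1, ← hv]; ring
      _ = _ := by ring
  have h3 := mul_left_cancel₀ (pow_ne_zero _ (X_sub_C_ne_zero r)) h2
  have h4 := congrArg (eval r) h3
  simp only [eval_mul, eval_add, eval_sub, eval_X, eval_C, sub_self, zero_mul, add_zero,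
    eval_natCast, eval_intCast] at h4
  have hu0 : eval r u ≠ 0 := fun h => hur (dvd_iff_isRoot.2 h)
  have hv0 : eval r v ≠ 0 := fun h => hvr (dvd_iff_isRoot.2 h)
  have h5 : ((α : ℂ) * j - β * i) * (eval r u * eval r v) = 0 := by linear_combination h4
  have h6 := (mul_eq_zero.1 h5).resolve_right (mul_ne_zero hu0 hv0)
  have : ((α * j : ℤ) : ℂ) = ((β * i : ℤ) : ℂ) := by push_cast; linear_combination h6
  exact_mod_cast this

theorem natDegree_eq_sum_rootMultiplicity (f : ℂ[X]) (s : Finset ℂ) (hs : ∀ r ∈ f.roots, r ∈ s) :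
    f.natDegree = ∑ r ∈ s, f.rootMultiplicity r := by
  classical
  rw [← IsAlgClosed.card_roots_eq_natDegree, ← Multiset.sum_count_eq_card hs]
  simp only [count_roots]

theorem natDegree_of_log_derivative {f g : ℂ[X]} (hf : f ≠ 0) (hg : g ≠ 0) {α β : ℤ}
    (h : (α : ℂ[X]) * f * derivative g = (β : ℂ[X]) * g * derivative f) :
    α * g.natDegree = β * f.natDegree := by
  classical
  rw [natDegree_eq_sum_rootMultiplicity f (f.roots.toFinset ∪ g.roots.toFinset)
      (fun r hr => by simp only [Finset.mem_union, Multiset.mem_toFinset]; exact Or.inl hr),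
    natDegree_eq_sum_rootMultiplicity g (f.roots.toFinset ∪ g.roots.toFinset)
      (fun r hr => by simp only [Finset.mem_union, Multiset.mem_toFinset]; exact Or.inr hr)]
  push_cast
  rw [Finset.mul_sum, Finset.mul_sum]
  exact Finset.sum_congr rfl fun r _ => rootMultiplicity_of_log_derivative hf hg h r

theorem exists_pow_eq_of_dvd_rootMultiplicity {f : ℂ[X]} {a : ℕ} (ha : 0 < a)
    (h : ∀ r, a ∣ f.rootMultiplicity r) : ∃ t : ℂ[X], t ^ a = f := by
  classical
  obtain ⟨γ, hγ⟩ := IsAlgClosed.exists_pow_nat_eq f.leadingCoeff ha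
  refine ⟨C γ * ∏ r ∈ f.roots.toFinset, (X - C r) ^ (f.rootMultiplicity r / a), ?_⟩
  have hsplit := (IsAlgClosed.splits f).eq_prod_roots
  rw [Finset.prod_multiset_map_count] at hsplit
  conv_rhs => rw [hsplit]
  rw [mul_pow, ← C_pow, hγ, ← Finset.prod_pow]
  congr 1
  refine Finset.prod_congr rfl fun r _ => ?_
  rw [← pow_mul, Nat.div_mul_cancel (h r), count_roots]

/-- Two distinct `a`-th powers whose bases have degree `e` differ in some degree at least
`(a - 1) e`. -/
theorem le_natDegree_of_pow_eq_pow_add {t u z : ℂ[X]} {a : ℕ} (ha : 0 < a) (hz : z ≠ 0)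
    (h : t ^ a = u ^ a + z) : (a - 1) * u.natDegree ≤ z.natDegree := by
  by_contra! hlt
  have hu : u ≠ 0 := by
    rintro rfl
    simp at hlt
  have hdeg : z.degree < (u ^ a).degree := by
    rw [degree_eq_natDegree hz, degree_eq_natDegree (pow_ne_zero _ hu), natDegree_pow]
    have : (a - 1) * u.natDegree ≤ a * u.natDegree := Nat.mul_le_mul_right _ (Nat.sub_le _ _)
    exact_mod_cast lt_of_lt_of_le hlt this
  have hlead : t.leadingCoeff ^ a = u.leadingCoeff ^ a := by
    rw [← leadingCoeff_pow, h, leadingCoeff_add_of_degree_lt' hdeg, leadingCoeff_pow]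
  have hnat : t.natDegree = u.natDegree := by
    have : (t ^ a).natDegree = (u ^ a).natDegree := by
      rw [h]
      exact natDegree_add_eq_left_of_degree_lt hdeg
    rw [natDegree_pow, natDegree_pow] at this
    exact Nat.eq_of_mul_eq_mul_left ha this
  have hul : u.leadingCoeff ≠ 0 := leadingCoeff_ne_zero.2 hu
  have htl : t.leadingCoeff ≠ 0 := by
    intro h0
    rw [h0, zero_pow ha.ne'] at hlead
    exact pow_ne_zero a hul hlead.symm
  -- Rescale `t` by a root of unity so that the leading coefficients agree.
  set ω := u.leadingCoeff / t.leadingCoeff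
  have hω : ω ^ a = 1 := by
    rw [div_pow, hlead, div_self (pow_ne_zero _ hul)]
  set t' := C ω * t
  have ht'a : t' ^ a = t ^ a := by rw [mul_pow, ← C_pow, hω, C_1, one_mul]
  have hω0 : ω ≠ 0 := div_ne_zero hul htl
  have ht'l : t'.leadingCoeff = u.leadingCoeff := by
    rw [leadingCoeff_mul, leadingCoeff_C]
    exact div_mul_cancel₀ _ htl
  have ht'n : t'.natDegree = u.natDegree := by rw [natDegree_C_mul hω0, hnat]
  have hfac : (∑ i ∈ Finset.range a, t' ^ i * u ^ (a - 1 - i)) * (t' - u) = z := by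
    rw [(Commute.all t' u).geom_sum₂_mul, ht'a, h]
    ring
  set s := ∑ i ∈ Finset.range a, t' ^ i * u ^ (a - 1 - i)
  have hcoeff : s.coeff ((a - 1) * u.natDegree) = a * u.leadingCoeff ^ (a - 1) := by
    rw [finsetSum_coeff, Finset.sum_congr rfl (g := fun _ => u.leadingCoeff ^ (a - 1)),
      Finset.sum_const, Finset.card_range, nsmul_eq_mul]
    intro i hi
    have hi' := Finset.mem_range.1 hi
    have : (t' ^ i * u ^ (a - 1 - i)).natDegree = (a - 1) * u.natDegree := by
      rw [natDegree_mul (pow_ne_zero _ _) (pow_ne_zero _ hu), natDegree_pow, natDegree_pow, ht'n,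
        ← add_mul]
      · congr 1; omega
      · exact mul_ne_zero (C_ne_zero.2 hω0) (leadingCoeff_ne_zero.1 htl)
    rw [← this, coeff_natDegree, leadingCoeff_mul, leadingCoeff_pow, leadingCoeff_pow, ht'l,
      ← pow_add]
    congr 1; omega
  have hs : (a - 1) * u.natDegree ≤ s.natDegree := by
    apply le_natDegree_of_ne_zero
    rw [hcoeff]
    exact mul_ne_zero (Nat.cast_ne_zero.2 ha.ne') (pow_ne_zero _ hul)
  have hz' := hz
  rw [← hfac] at hz'
  have := natDegree_mul (left_ne_zero_of_mul hz') (right_ne_zero_of_mul hz')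
  rw [hfac] at this
  omega

/-- A root of `w` at which `z` vanishes to at most the average order. -/
theorem exists_root_rootMultiplicity_le {w z : ℂ[X]} (hw : 0 < w.natDegree) :
    ∃ r, 0 < w.rootMultiplicity r ∧
      z.rootMultiplicity r * w.natDegree ≤ z.natDegree * w.rootMultiplicity r := by
  classical
  have hw0 : w ≠ 0 := by rintro rfl; simp at hw
  by_contra! hcon
  have hmem : ∀ r ∈ w.roots.toFinset, 0 < w.rootMultiplicity r := fun r hr =>
    (rootMultiplicity_pos hw0).2 (isRoot_of_mem_roots (Multiset.mem_toFinset.1 hr))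
  have hsum := natDegree_eq_sum_rootMultiplicity w w.roots.toFinset (fun r hr => by simpa using hr)
  have hz : ∑ r ∈ w.roots.toFinset, z.rootMultiplicity r ≤ z.natDegree := by
    rw [natDegree_eq_sum_rootMultiplicity z (w.roots.toFinset ∪ z.roots.toFinset)
      (fun r hr => by simp only [Finset.mem_union, Multiset.mem_toFinset]; exact Or.inr hr)]
    exact Finset.sum_le_sum_of_subset Finset.subset_union_left
  have hne : w.roots.toFinset.Nonempty := by
    rw [Finset.nonempty_iff_ne_empty]
    intro h
    rw [h, Finset.sum_empty] at hsum
    omega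
  have h1 : ∑ r ∈ w.roots.toFinset, z.natDegree * w.rootMultiplicity r <
      ∑ r ∈ w.roots.toFinset, z.rootMultiplicity r * w.natDegree :=
    Finset.sum_lt_sum_of_nonempty hne fun r hr => hcon r (hmem r hr)
  rw [← Finset.mul_sum, ← Finset.sum_mul, ← hsum] at h1
  exact absurd h1 (not_lt.2 (Nat.mul_le_mul_right _ hz))

theorem rootMultiplicity_le_natDegree (f : ℂ[X]) (r : ℂ) :
    f.rootMultiplicity r ≤ f.natDegree := by
  classical
  rw [← count_roots]
  exact (Multiset.count_le_card _ _).trans (card_roots' f)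

theorem rootMultiplicity_pow (f : ℂ[X]) (n : ℕ) (r : ℂ) :
    (f ^ n).rootMultiplicity r = n * f.rootMultiplicity r := by
  classical
  rw [← count_roots, ← count_roots, roots_pow, Multiset.count_nsmul]

theorem rootMultiplicity_zero_eq {f : ℂ[X]} {n : ℕ} (hlow : ∀ q < n, f.coeff q = 0)
    (hn : f.coeff n ≠ 0) : f.rootMultiplicity 0 = n := by
  rw [rootMultiplicity_eq_natTrailingDegree']
  exact le_antisymm (natTrailingDegree_le_of_ne_zero hn)
    (le_natTrailingDegree (fun h => hn (by rw [h, coeff_zero])) hlow)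

theorem coeff_taylor_rootMultiplicity {f : ℂ[X]} (hf : f ≠ 0) (r : ℂ) :
    (taylor r f).coeff (f.rootMultiplicity r) ≠ 0 := by
  rw [rootMultiplicity_eq_natTrailingDegree, ← taylor_apply]
  have : taylor r f ≠ 0 := fun h => hf ((taylor_injective r) (by rw [h, map_zero]))
  exact mt (trailingCoeff_eq_zero (p := taylor r f)).1 this

theorem coeff_taylor_of_lt_rootMultiplicity {f : ℂ[X]} {r : ℂ} {q : ℕ}
    (hq : q < f.rootMultiplicity r) : (taylor r f).coeff q = 0 := by
  rw [rootMultiplicity_eq_natTrailingDegree, ← taylor_apply] at hq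
  exact coeff_eq_zero_of_lt_natTrailingDegree hq

theorem eq_of_rootMultiplicity_eq_natDegree {f : ℂ[X]} {r : ℂ}
    (h : f.rootMultiplicity r = f.natDegree) :
    f = C f.leadingCoeff * (X - C r) ^ f.natDegree := by
  rcases eq_or_ne f 0 with rfl | hf
  · simp
  obtain ⟨u, hu, hur⟩ := exists_eq_pow_rootMultiplicity_mul_and_not_dvd f hf r
  have hu0 : u ≠ 0 := by rintro rfl; simp at hur
  rw [h] at hu
  have hdeg := congrArg natDegree hu
  rw [natDegree_mul (pow_ne_zero _ (X_sub_C_ne_zero r)) hu0, natDegree_pow, natDegree_X_sub_C] at hdeg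
  obtain ⟨c, rfl⟩ := natDegree_eq_zero.1 (show u.natDegree = 0 by omega)
  have hl := congrArg leadingCoeff hu
  rw [leadingCoeff_mul, leadingCoeff_pow, leadingCoeff_X_sub_C, one_pow, one_mul,
    leadingCoeff_C] at hl
  rw [hl]
  conv_lhs => rw [hu]
  ring

namespace Chart

/-! ### The descent -/

/-- The data followed through the changes of chart: `F = P(W) + Z` with `P` monic of degree `d`,
bounds `p` and `DZ` for the degrees of `W` and `Z` in `t`, and two integers `μ` and `ν` which stand
for the degrees in `y` of the leading coefficients of `W` and `Z`, or for their orders of vanishing at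
`y = 0`. The power `t ^ E` is the bracket of `F` with its partner, up to a constant.

In the plane of exponents, `(d * p, d * μ)` is the corner of `P(W)` and `(DZ, ν)` that of `Z`. The
conditions `pos` and `line` say that the line through these two points passes to the right of `(0, 0)`
and of `a / (a + b) • (E, 1)`. Both are invariant under the monomial substitutions of `t` and `y`; they
ensure that when `Z` catches up with `P(W)`, the leading term of `F` still has positive degree and is
still dependent on that of its partner. -/
structure Core (a b d μ ν : ℕ) (p DZ E : ℤ) (F W Z : Chart) : Prop where
  rel : ∃ P : ℂ[X], P.Monic ∧ P.natDegree = d ∧ F = aeval W P + Z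
  degW : DegLE W p
  degZ : DegLE Z DZ
  le : DZ ≤ d * p
  ratio : a * ν < (a - 1) * (d * μ)
  pos : (ν : ℤ) * (d * p) < d * μ * DZ
  line : a * (E * (d * μ - ν) - (d * p - DZ)) < (a + b) * ((d : ℤ) * μ * DZ - ν * (d * p))

/-- A `Core` together with the second polynomial `G`, of degree `DG` in `t`. -/
structure Stage (a b d μ ν : ℕ) (p DZ DG E : ℤ) (F G W Z : Chart) : Prop
    extends Core a b d μ ν p DZ E F W Z where
  degG : DegLE G DG
  topG : G.coeff DG ≠ 0
  hDG : a * DG = b * (d * p)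
  jac : ∃ κ : ℂ, bracket F G = AddMonoidAlgebra.single E (Polynomial.C κ)

namespace Core

variable {a b d μ ν : ℕ} {p DZ E : ℤ} {F G W Z : Chart}

theorem a_pos (h : Core a b d μ ν p DZ E F W Z) : 0 < a := by
  rcases Nat.eq_zero_or_pos a with rfl | ha
  · have := h.ratio; simp at this
  · exact ha

theorem lt (h : Core a b d μ ν p DZ E F W Z) : ν < d * μ := by
  have h1 := h.ratio
  have h2 : (a - 1) * (d * μ) ≤ a * (d * μ) := Nat.mul_le_mul_right _ (Nat.sub_le _ _)
  exact lt_of_mul_lt_mul_left (h1.trans_le h2) (Nat.zero_le a)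

theorem lt_int (h : Core a b d μ ν p DZ E F W Z) : (ν : ℤ) < d * μ := by
  exact_mod_cast h.lt

theorem dmu_pos (h : Core a b d μ ν p DZ E F W Z) : 0 < d * μ :=
  (Nat.zero_le _).trans_lt h.lt

theorem d_pos (h : Core a b d μ ν p DZ E F W Z) : 0 < d :=
  Nat.pos_of_mul_pos_right h.dmu_pos

theorem mu_pos (h : Core a b d μ ν p DZ E F W Z) : 0 < μ :=
  Nat.pos_of_mul_pos_left h.dmu_pos

theorem dp_pos (h : Core a b d μ ν p DZ E F W Z) : 0 < (d : ℤ) * p := by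
  by_contra! hcon
  have h1 := h.lt_int
  have h2 := h.le
  have h3 := h.pos
  nlinarith

theorem p_pos (h : Core a b d μ ν p DZ E F W Z) : 0 < p :=
  pos_of_mul_pos_right h.dp_pos (by positivity)

/-- The bracket has smaller degree than the product of the leading terms of `F` and `G`, so these
leading terms are dependent. -/
theorem crit (h : Core a b d μ ν p DZ E F W Z) : a * E < (a + b) * (d * p) := by
  have h1 := h.lt_int
  have h2 := h.le
  have h3 := h.line
  have ha : (1 : ℤ) ≤ a := by exact_mod_cast h.a_pos
  have hM : (1 : ℤ) ≤ d * μ := by exact_mod_cast h.dmu_pos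
  have h4 : 0 < ((a + b) * (d * p) - a * E) * ((d : ℤ) * μ - ν) := by
    have h5 : (0 : ℤ) ≤ (a * (d * μ - 1) + b * (d * μ)) * (d * p - DZ) := by
      apply mul_nonneg _ (by linarith)
      have : (0 : ℤ) ≤ b := by positivity
      nlinarith
    nlinarith
  have h6 := pos_of_mul_pos_left h4 (by linarith)
  linarith

theorem degF (h : Core a b d μ ν p DZ E F W Z) : DegLE F (d * p) := by
  obtain ⟨P, hP, hd, rfl⟩ := h.rel
  have := (aeval_leading h.degW h.p_pos hP).1
  rw [hd] at this
  exact this.add (h.degZ.mono h.le)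

theorem topF (h : Core a b d μ ν p DZ E F W Z) :
    F.coeff (d * p) = W.coeff p ^ d + Z.coeff (d * p) := by
  obtain ⟨P, hP, hd, rfl⟩ := h.rel
  have := (aeval_leading h.degW h.p_pos hP).2
  rw [hd] at this
  rw [AddMonoidAlgebra.coeff_add, Finsupp.add_apply, this]

theorem bracket_top_eq_zero (h : Core a b d μ ν p DZ E F W Z)
    (hJ : ∃ κ : ℂ, bracket F G = AddMonoidAlgebra.single E (Polynomial.C κ)) {e : ℤ}
    (hG : DegLE G e) (he : b * (d * p) ≤ a * e) :
    ((d * p : ℤ) : ℂ[X]) * F.coeff (d * p) * derivative (G.coeff e) =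
      (e : ℂ[X]) * G.coeff e * derivative (F.coeff (d * p)) := by
  obtain ⟨κ, hκ⟩ := hJ
  have h1 := coeff_bracket h.degF hG
  have h2 : E < d * p + e := by
    have ha : (0 : ℤ) < a := by exact_mod_cast h.a_pos
    have h3 := h.crit
    have : (a : ℤ) * E < a * (d * p + e) := by linarith
    exact lt_of_mul_lt_mul_left this ha.le
  rw [hκ, AddMonoidAlgebra.coeff_single, Finsupp.single_apply, if_neg (by omega)] at h1
  exact sub_eq_zero.1 h1.symm

end Core

namespace Stage

variable {a b d μ ν : ℕ} {p DZ DG E : ℤ} {F G W Z : Chart}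

/-- The divisors of the leading coefficients of `F` and `G` are in proportion `a : b`. -/
theorem rootMultiplicity_top (h : Stage a b d μ ν p DZ DG E F G W Z)
    (hF : F.coeff (d * p) ≠ 0) (r : ℂ) :
    a * (G.coeff DG).rootMultiplicity r = b * (F.coeff (d * p)).rootMultiplicity r := by
  have h1 := rootMultiplicity_of_log_derivative hF h.topG (h.bracket_top_eq_zero h.jac h.degG h.hDG.ge) r
  have h2 : (d * p : ℤ) * ((a : ℤ) * (G.coeff DG).rootMultiplicity r) =
      (d * p : ℤ) * (b * (F.coeff (d * p)).rootMultiplicity r) := by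
    calc _ = (a : ℤ) * (d * p * (G.coeff DG).rootMultiplicity r) := by ring
      _ = (a * DG) * (F.coeff (d * p)).rootMultiplicity r := by rw [h1]; ring
      _ = _ := by rw [h.hDG]; ring
  exact_mod_cast mul_left_cancel₀ h.dp_pos.ne' h2

/-- The leading terms of `P(W)` and `Z` cannot have the same degree: that of `F` is an `a`-th power
and so is that of `P(W)`, but the leading coefficient of `Z` has too small a degree to be their
difference. -/
theorem not_eq (h : Stage a b d μ ν p DZ DG E F G W Z) (hab : a.Coprime b) (had : a ∣ d)
    (hW : (W.coeff p).natDegree = μ) (hZ : (Z.coeff DZ).natDegree = ν) (hZ0 : Z.coeff DZ ≠ 0) :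
    DZ ≠ d * p := by
  intro heq
  obtain ⟨δ, rfl⟩ := had
  have hlt := h.lt
  have htop := h.topF
  rw [← heq] at htop
  have hdeg : (F.coeff DZ).natDegree = a * δ * μ := by
    rw [htop, natDegree_add_eq_left_of_natDegree_lt] <;> rw [natDegree_pow, hW]
    rwa [hZ]
  have hF : F.coeff DZ ≠ 0 := by
    intro h0
    rw [h0, natDegree_zero] at hdeg
    omega
  obtain ⟨t, ht⟩ := exists_pow_eq_of_dvd_rootMultiplicity (f := F.coeff DZ) h.a_pos (by
    intro r
    have := h.rootMultiplicity_top (heq ▸ hF) r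
    rw [← heq] at this
    exact hab.dvd_of_dvd_mul_left ⟨_, this.symm⟩)
  have hpow : t ^ a = (W.coeff p ^ δ) ^ a + Z.coeff DZ := by
    rw [ht, htop, ← pow_mul, mul_comm δ a]
  have := le_natDegree_of_pow_eq_pow_add h.a_pos hZ0 hpow
  rw [natDegree_pow, hW, hZ] at this
  have hr := h.ratio
  have : a * ((a - 1) * (δ * μ)) ≤ a * ν := Nat.mul_le_mul_left _ this
  have e : a * ((a - 1) * (δ * μ)) = (a - 1) * (a * δ * μ) := by ring
  omega

/-- The inequalities persist when `y` is shifted to a root at which `Z` vanishes to at most average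
order. -/
theorem shift (h : Stage a b d μ ν p DZ DG E F G W Z) (r : ℂ) {μ' ν' : ℕ} (hμ' : 0 < μ')
    (hμ : μ' ≤ μ) (hν : ν' * μ ≤ ν * μ') :
    Stage a b d μ' ν' p DZ DG E (shift r F) (shift r G) (shift r W) (shift r Z) where
  rel := by
    obtain ⟨P, hP, hd, rfl⟩ := h.rel
    exact ⟨P, hP, hd, by rw [map_add, ← aeval_algHom_apply]⟩
  degW := fun n hn => by rw [coeff_shift, h.degW n hn, map_zero]
  degZ := fun n hn => by rw [coeff_shift, h.degZ n hn, map_zero]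
  degG := fun n hn => by rw [coeff_shift, h.degG n hn, map_zero]
  topG := by
    rw [coeff_shift]
    exact fun h0 => h.topG ((taylor_injective r) (by rw [h0, map_zero]))
  le := h.le
  hDG := h.hDG
  jac := by
    obtain ⟨κ, hκ⟩ := h.jac
    refine ⟨κ, ?_⟩
    rw [bracket_shift, hκ]
    ext1; ext1 n
    rw [coeff_shift, AddMonoidAlgebra.coeff_single, Finsupp.single_apply]
    split_ifs <;> simp
  ratio := by
    have hmu := h.mu_pos
    have h1 := h.ratio
    have : (a * ν') * μ < ((a - 1) * (d * μ')) * μ := by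
      calc (a * ν') * μ = a * (ν' * μ) := by ring
        _ ≤ a * (ν * μ') := Nat.mul_le_mul_left _ hν
        _ = (a * ν) * μ' := by ring
        _ < ((a - 1) * (d * μ)) * μ' := Nat.mul_lt_mul_of_pos_right h1 hμ'
        _ = _ := by ring
    exact lt_of_mul_lt_mul_right this (Nat.zero_le _)
  pos := by
    have hmu : (0 : ℤ) < μ := by exact_mod_cast h.mu_pos
    have hmu' : (0 : ℤ) < μ' := by exact_mod_cast hμ'
    have hν' : (ν' : ℤ) * μ ≤ ν * μ' := by exact_mod_cast hν
    have h1 := mul_lt_mul_of_pos_right h.pos hmu'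
    have h2 := mul_le_mul_of_nonneg_right hν' h.dp_pos.le
    have : (ν' * (d * p)) * (μ : ℤ) < (d * μ' * DZ) * μ := by linarith
    exact lt_of_mul_lt_mul_right this hmu.le
  line := by
    have hmu : (0 : ℤ) < μ := by exact_mod_cast h.mu_pos
    have hmu' : (0 : ℤ) < μ' := by exact_mod_cast hμ'
    have hν' : (0 : ℤ) ≤ ν * μ' - ν' * μ := sub_nonneg.2 (by exact_mod_cast hν)
    have hμ2 : (0 : ℤ) ≤ μ - μ' := sub_nonneg.2 (by exact_mod_cast hμ)
    have h1 := mul_lt_mul_of_pos_right h.line hmu'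
    have h2 := mul_nonneg hν' (sub_nonneg.2 h.crit.le)
    have h3 := mul_nonneg (mul_nonneg (Nat.cast_nonneg (α := ℤ) a) hμ2) (sub_nonneg.2 h.le)
    have : (a * (E * (d * μ' - ν') - (d * p - DZ))) * (μ : ℤ) <
        ((a + b) * ((d : ℤ) * μ' * DZ - ν' * (d * p))) * μ := by linarith
    exact lt_of_mul_lt_mul_right this hmu.le

end Stage

/-- The leading coefficient after the substitution `t ↦ t ^ k`, `y ↦ t ^ (-θ) y`, when `θ / k` is at
most the slope of the edge of the Newton polygon which goes down from the vertex `(D, ν)`. -/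
theorem subst_leading {f : Chart} {D : ℤ} {ν : ℕ} {k θ : ℤ} (hk : 0 < k) (hθ : 0 < θ)
    (hD : DegLE f D) (hν : (f.coeff D).coeff ν ≠ 0)
    (hs : ∀ i q, q < ν → (f.coeff i).coeff q ≠ 0 → θ * (ν - q) ≤ k * (D - i)) :
    DegLE (subst k θ f) (k * D - θ * ν) ∧
      ((subst k θ f).coeff (k * D - θ * ν)).natDegree = ν ∧
      (subst k θ f).coeff (k * D - θ * ν) ≠ 0 := by
  have hle : ∀ i, f.coeff i ≠ 0 → i ≤ D := fun i hi => by
    by_contra! hlt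
    exact hi (hD i hlt)
  have hne := coeff_subst_image hk.ne' θ f D ν ▸ hν
  refine ⟨?_, le_antisymm ?_ (le_natDegree_of_ne_zero hne), fun h0 => hne (by rw [h0]; simp)⟩
  · intro e he
    ext q
    rw [Polynomial.coeff_zero]
    by_contra hcon
    obtain ⟨i, rfl, hi⟩ := exists_of_coeff_subst_ne_zero hk.ne' hcon
    have hiD := hle i (fun h0 => hi (by rw [h0]; simp))
    rcases lt_or_ge q ν with hq | hq
    · have := hs i q hq hi
      linarith
    · have h1 : (ν : ℤ) ≤ q := by exact_mod_cast hq
      have h2 := mul_le_mul_of_nonneg_left hiD hk.le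
      have h3 := mul_le_mul_of_nonneg_left h1 hθ.le
      linarith
  · rw [natDegree_le_iff_coeff_eq_zero]
    intro q hq
    by_contra hcon
    obtain ⟨i, hei, hi⟩ := exists_of_coeff_subst_ne_zero hk.ne' hcon
    have hiD := hle i (fun h0 => hi (by rw [h0]; simp))
    have h1 : (ν : ℤ) < q := by exact_mod_cast hq
    have h2 := mul_le_mul_of_nonneg_left hiD hk.le
    have h3 := mul_lt_mul_of_pos_left h1 hθ
    linarith

/-- The least of finitely many positive slopes, as a reduced fraction. -/
theorem exists_min_slope (s : Finset ℚ) (hs : s.Nonempty) (hpos : ∀ x ∈ s, 0 < x) :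
    ∃ k θ : ℤ, 0 < k ∧ 0 < θ ∧ (∀ x ∈ s, (θ : ℚ) ≤ k * x) ∧ (∃ x ∈ s, (θ : ℚ) = k * x) ∧
      ∀ n : ℤ, θ = k * n → k = 1 := by
  obtain ⟨x, hx, hmin⟩ := s.exists_min_image id hs
  have hden : (0 : ℚ) < x.den := by exact_mod_cast x.den_pos
  have hnum : (x.num : ℚ) = x.den * x := by rw [Rat.den_mul_eq_num]
  refine ⟨x.den, x.num, by exact_mod_cast x.den_pos, Rat.num_pos.2 (hpos x hx), ?_,
    ⟨x, hx, by exact_mod_cast hnum⟩, ?_⟩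
  · intro y hy
    rw [hnum]
    exact mul_le_mul_of_nonneg_left (hmin y hy) hden.le
  · intro n hn
    have h1 : x.den ∣ x.num.natAbs := Int.natCast_dvd.1 ⟨n, hn⟩
    have h2 := Nat.Coprime.eq_one_of_dvd x.reduced.symm h1
    exact_mod_cast h2

/-- The slopes of the segments which join the vertex `(D, ν)` to the lower points of the support. -/
theorem exists_slopes {f : Chart} {D : ℤ} {ν : ℕ} (hD : DegLE f D)
    (hlow : ∀ q < ν, (f.coeff D).coeff q = 0) :
    ∃ s : Finset ℚ, (∀ x ∈ s, 0 < x ∧ ∃ i q, q < ν ∧ (f.coeff i).coeff q ≠ 0 ∧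
        x = ((D - i : ℤ) : ℚ) / ((ν - q : ℤ) : ℚ)) ∧
      ∀ i q, q < ν → (f.coeff i).coeff q ≠ 0 → ((D - i : ℤ) : ℚ) / ((ν - q : ℤ) : ℚ) ∈ s := by
  classical
  refine ⟨((f.coeff.support ×ˢ Finset.range ν).filter
    (fun z => (f.coeff z.1).coeff z.2 ≠ 0)).image
      (fun z => ((D - z.1 : ℤ) : ℚ) / ((ν - z.2 : ℤ) : ℚ)), ?_, ?_⟩
  · intro x hx
    obtain ⟨⟨i, q⟩, hz, rfl⟩ := Finset.mem_image.1 hx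
    obtain ⟨hz1, hne⟩ := Finset.mem_filter.1 hz
    obtain ⟨hi, hq⟩ := Finset.mem_product.1 hz1
    have hq' := Finset.mem_range.1 hq
    refine ⟨?_, i, q, hq', hne, rfl⟩
    have h1 : i ≤ D := by
      by_contra! hlt
      exact Finsupp.mem_support_iff.1 hi (hD i hlt)
    have h2 : i ≠ D := by
      rintro rfl
      exact hne (hlow q hq')
    have h3 : (0 : ℤ) < D - i := by omega
    have h4 : (0 : ℤ) < ν - q := by simp only at hq'; omega
    exact div_pos (by exact_mod_cast h3) (by exact_mod_cast h4)
  · intro i q hq hne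
    refine Finset.mem_image.2 ⟨(i, q), Finset.mem_filter.2 ⟨Finset.mem_product.2
      ⟨Finsupp.mem_support_iff.2 fun h0 => hne ?_, Finset.mem_range.2 hq⟩, hne⟩, rfl⟩
    simp only at h0
    rw [h0, Polynomial.coeff_zero]

theorem le_mul_slope_iff {k θ x y : ℤ} (hy : 0 < y) :
    (θ : ℚ) ≤ k * ((x : ℚ) / (y : ℚ)) ↔ θ * y ≤ k * x := by
  rw [← mul_div_assoc, le_div_iff₀ (by exact_mod_cast hy)]
  exact_mod_cast Iff.rfl

theorem eq_mul_slope_iff {k θ x y : ℤ} (hy : 0 < y) :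
    (θ : ℚ) = k * ((x : ℚ) / (y : ℚ)) ↔ θ * y = k * x := by
  rw [← mul_div_assoc, eq_div_iff (by exact_mod_cast hy.ne')]
  exact_mod_cast Iff.rfl

theorem exists_degLE {f : Chart} {e : ℤ} (h : ¬ DegLE f e) :
    ∃ D, e < D ∧ DegLE f D ∧ f.coeff D ≠ 0 := by
  simp only [DegLE, not_forall] at h
  obtain ⟨n, hn, hne⟩ := h
  obtain ⟨D, hD, hmax⟩ := f.coeff.support.exists_max_image id ⟨n, Finsupp.mem_support_iff.2 hne⟩
  refine ⟨D, hn.trans_le (hmax n (Finsupp.mem_support_iff.2 hne)), ?_, Finsupp.mem_support_iff.1 hD⟩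
  intro j hj
  by_contra hcon
  exact absurd (hmax j (Finsupp.mem_support_iff.2 hcon)) (not_le.2 hj)

variable {a b d μ ν : ℕ} {p DZ DG E : ℤ} {F G W Z : Chart}

theorem Core.subst (h : Core a b d μ ν p DZ E F W Z) {k θ : ℤ} (hk : 0 < k)
    (hW : DegLE (subst k θ W) (k * p - θ * μ)) (hZ : DegLE (subst k θ Z) (k * DZ - θ * ν))
    (hWZ : θ * (d * μ - ν) ≤ k * (d * p - DZ)) :
    Core a b d μ ν (k * p - θ * μ) (k * DZ - θ * ν) (k * E - θ) (subst k θ F) (subst k θ W)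
      (subst k θ Z) where
  rel := by
    obtain ⟨P, hP, hd, rfl⟩ := h.rel
    exact ⟨P, hP, hd, by rw [map_add, ← aeval_algHom_apply]⟩
  degW := hW
  degZ := hZ
  le := by linarith
  ratio := h.ratio
  pos := by
    have := mul_lt_mul_of_pos_left h.pos hk
    linarith
  line := by
    have := mul_lt_mul_of_pos_left h.line hk
    linarith

/-- A substitution whose slope is at most those of the edges of `W` and `Z`, and which does not let
`Z` overtake `P(W)`, leads to another stage. The degree of `G` stays proportional to that of `F`
because a larger one would come, by the dependence of the leading terms, from a monomial of `G` which
lies too far to the right. -/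
theorem Stage.subst (h : Stage a b d μ ν p DZ DG E F G W Z) (hlt : DZ < d * p) {k θ : ℤ}
    (hk : 0 < k) (hWlow : ∀ q < μ, (W.coeff p).coeff q = 0) (hWμ : (W.coeff p).coeff μ ≠ 0)
    (hW : DegLE (subst k θ W) (k * p - θ * μ)) (hZ : DegLE (subst k θ Z) (k * DZ - θ * ν))
    (hWdeg : ((subst k θ W).coeff (k * p - θ * μ)).natDegree = μ)
    (hZdeg : ((subst k θ Z).coeff (k * DZ - θ * ν)).natDegree = ν)
    (hWZ : θ * (d * μ - ν) ≤ k * (d * p - DZ)) :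
    ∃ DG', Stage a b d μ ν (k * p - θ * μ) (k * DZ - θ * ν) DG' (k * E - θ) (subst k θ F)
      (subst k θ G) (subst k θ W) (subst k θ Z) := by
  have hc := h.toCore.subst hk hW hZ hWZ
  have ha : (0 : ℤ) < a := by exact_mod_cast h.a_pos
  have hjac : ∃ κ : ℂ, bracket (Chart.subst k θ F) (Chart.subst k θ G) =
      AddMonoidAlgebra.single (k * E - θ) (Polynomial.C κ) := by
    obtain ⟨κ, hκ⟩ := h.jac
    refine ⟨k * κ, ?_⟩
    rw [bracket_subst hk.ne', hκ, ← monomial_zero_left, subst_single, LaurentPolynomial.T, mul_assoc,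
      AddMonoidAlgebra.single_mul_single, ← zsmul_eq_mul, AddMonoidAlgebra.smul_single, one_mul,
      zsmul_eq_mul, monomial_zero_left, ← Polynomial.C_eq_intCast, ← Polynomial.C_mul]
    congr 1
    push_cast; ring
  -- The order in `y` of the leading coefficient of `G`.
  set j := (G.coeff DG).rootMultiplicity 0 with hj
  have hWord : (W.coeff p).rootMultiplicity 0 = μ := rootMultiplicity_zero_eq hWlow hWμ
  have hFtop : F.coeff (d * p) = W.coeff p ^ d := by
    rw [h.topF, h.degZ _ hlt, add_zero]
  have hW0 : W.coeff p ≠ 0 := fun h0 => hWμ (by rw [h0]; simp)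
  have haj : (a : ℤ) * j = b * (d * μ) := by
    have h1 := h.rootMultiplicity_top (by rw [hFtop]; exact pow_ne_zero _ hW0) 0
    rw [hFtop, rootMultiplicity_pow, hWord] at h1
    exact_mod_cast h1
  have hDG' : (a : ℤ) * (k * DG - θ * j) = b * (d * (k * p - θ * μ)) := by
    calc _ = k * (a * DG) - θ * (a * j) := by ring
      _ = _ := by rw [h.hDG, haj]; ring
  have htop : ((Chart.subst k θ G).coeff (k * DG - θ * j)).coeff j ≠ 0 := by
    rw [coeff_subst_image hk.ne']
    have := coeff_taylor_rootMultiplicity h.topG 0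
    rwa [taylor_zero] at this
  refine ⟨k * DG - θ * j, hc, ?_, fun h0 => htop (by rw [h0]; simp), hDG', hjac⟩
  by_contra hcon
  obtain ⟨D, hD, hGD, hne⟩ := exists_degLE hcon
  have haD : (b : ℤ) * (d * (k * p - θ * μ)) < a * D := hDG' ▸ mul_lt_mul_of_pos_left hD ha
  have hrel := hc.bracket_top_eq_zero hjac hGD haD.le
  have hFdeg : ((Chart.subst k θ F).coeff (d * (k * p - θ * μ))).natDegree = d * μ := by
    have hpow : ((Chart.subst k θ W).coeff (k * p - θ * μ) ^ d).natDegree = d * μ := by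
      rw [natDegree_pow, hWdeg]
    rw [hc.topF]
    rcases hc.le.lt_or_eq with hl | hl
    · rw [hZ _ hl, add_zero, hpow]
    · rw [natDegree_add_eq_left_of_natDegree_lt, hpow]
      rw [hpow, ← hl, hZdeg]
      exact h.lt
  have hF0 : (Chart.subst k θ F).coeff (d * (k * p - θ * μ)) ≠ 0 := by
    intro h0
    rw [h0, natDegree_zero] at hFdeg
    have := h.dmu_pos
    omega
  have hdeg := natDegree_of_log_derivative hF0 hne hrel
  rw [hFdeg] at hdeg
  set J := ((Chart.subst k θ G).coeff D).natDegree
  obtain ⟨i, hi, hGi⟩ := exists_of_coeff_subst_ne_zero hk.ne'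
    (show ((Chart.subst k θ G).coeff D).coeff J ≠ 0 from leadingCoeff_ne_zero.2 hne)
  have hiDG : i ≤ DG := by
    by_contra! hl
    exact hGi (by rw [h.degG i hl, Polynomial.coeff_zero])
  have hd : (0 : ℤ) < d := by exact_mod_cast h.d_pos
  have hM : (0 : ℤ) < d * μ := by exact_mod_cast h.dmu_pos
  have hp1 := hc.dp_pos
  have hiJ : i * μ = p * J := by
    rw [hi] at hdeg
    push_cast at hdeg
    have : (k * d) * (i * μ) = (k * d) * (p * J) := by linear_combination -hdeg
    exact mul_left_cancel₀ (mul_pos hk hd).ne' this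
  have hJ : (b : ℤ) * (d * μ) < a * J := by
    have h1 := mul_lt_mul_of_pos_right haD hM
    have h2 : (d * (k * p - θ * μ)) * ((b : ℤ) * (d * μ)) < (d * (k * p - θ * μ)) * (a * J) := by
      push_cast at hdeg
      linear_combination h1 - a * hdeg
    exact lt_of_mul_lt_mul_left h2 hp1.le
  have hmu : (0 : ℤ) < μ := by exact_mod_cast h.mu_pos
  have h1 : (a * i) * (μ : ℤ) ≤ (a * DG) * μ :=
    mul_le_mul_of_nonneg_right (mul_le_mul_of_nonneg_left hiDG ha.le) hmu.le
  have h2 := mul_lt_mul_of_pos_left hJ h.p_pos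
  rw [h.hDG] at h1
  have h3 : a * i * μ = p * (a * J) := by linear_combination (a : ℤ) * hiJ
  linarith

/-- One step of the descent, from a chart in which `μ` and `ν` are orders of vanishing at `y = 0` to
one in which they are degrees in `y`: the slope `θ / k` is the first at which `W` or `Z` has an edge or
at which `Z` catches up with `P(W)`. -/
theorem Stage.exists_subst (h : Stage a b d μ ν p DZ DG E F G W Z) (hlt : DZ < d * p)
    (hWlow : ∀ q < μ, (W.coeff p).coeff q = 0) (hWμ : (W.coeff p).coeff μ ≠ 0)
    (hZlow : ∀ q < ν, (Z.coeff DZ).coeff q = 0) (hZν : (Z.coeff DZ).coeff ν ≠ 0) :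
    ∃ (k θ : ℤ) (p' DZ' DG' E' : ℤ) (F' G' W' Z' : Chart),
      Stage a b d μ ν p' DZ' DG' E' F' G' W' Z' ∧
      (W'.coeff p').natDegree = μ ∧ (Z'.coeff DZ').natDegree = ν ∧
      W'.coeff p' ≠ 0 ∧ Z'.coeff DZ' ≠ 0 ∧
      0 < θ ∧ p' = k * p - θ * μ ∧ DZ' = k * DZ - θ * ν ∧
      (DZ' = d * p' ∨ (∃ q < μ, (W'.coeff p').coeff q ≠ 0) ∨
        ∃ q < ν, (Z'.coeff DZ').coeff q ≠ 0) ∧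
      ((W'.coeff p').coeff (μ - 1) ≠ 0 → k = 1) := by
  classical
  obtain ⟨sW, hsW, hsW'⟩ := exists_slopes h.degW hWlow
  obtain ⟨sZ, hsZ, hsZ'⟩ := exists_slopes h.degZ hZlow
  have hMν : (0 : ℤ) < d * μ - ν := by linarith [h.lt_int]
  have hΔ : (0 : ℤ) < d * p - DZ := by linarith
  set x₀ : ℚ := ((d * p - DZ : ℤ) : ℚ) / ((d * μ - ν : ℤ) : ℚ) with hx₀
  obtain ⟨k, θ, hk, hθ, hmin, ⟨x, hx, hxeq⟩, hk1⟩ := exists_min_slope (insert x₀ (sW ∪ sZ))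
    (Finset.insert_nonempty _ _) (by
      intro x hx
      rcases Finset.mem_insert.1 hx with rfl | hx
      · exact div_pos (by exact_mod_cast hΔ) (by exact_mod_cast hMν)
      · rcases Finset.mem_union.1 hx with hx | hx
        · exact (hsW x hx).1
        · exact (hsZ x hx).1)
  have hslopeW : ∀ i q, q < μ → (W.coeff i).coeff q ≠ 0 → θ * (μ - q) ≤ k * (p - i) := by
    intro i q hq hne
    rw [← le_mul_slope_iff (by omega)]
    exact hmin _ (Finset.mem_insert_of_mem (Finset.mem_union_left _ (hsW' i q hq hne)))
  have hslopeZ : ∀ i q, q < ν → (Z.coeff i).coeff q ≠ 0 → θ * (ν - q) ≤ k * (DZ - i) := by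
    intro i q hq hne
    rw [← le_mul_slope_iff (by omega)]
    exact hmin _ (Finset.mem_insert_of_mem (Finset.mem_union_right _ (hsZ' i q hq hne)))
  obtain ⟨hW1, hW2, hW3⟩ := subst_leading hk hθ h.degW hWμ hslopeW
  obtain ⟨hZ1, hZ2, hZ3⟩ := subst_leading hk hθ h.degZ hZν hslopeZ
  have hWZ : θ * (d * μ - ν) ≤ k * (d * p - DZ) := by
    rw [← le_mul_slope_iff hMν]
    exact hmin _ (Finset.mem_insert_self _ _)
  obtain ⟨DG', hst⟩ := h.subst hlt hk hWlow hWμ hW1 hZ1 hW2 hZ2 hWZ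
  refine ⟨k, θ, _, _, DG', _, _, _, _, _, hst, hW2, hZ2, hW3, hZ3, hθ, rfl, rfl, ?_, ?_⟩
  · rcases Finset.mem_insert.1 hx with rfl | hx
    · left
      rw [hx₀, eq_mul_slope_iff hMν] at hxeq
      linarith
    · right
      rcases Finset.mem_union.1 hx with hx | hx
      · left
        obtain ⟨-, i, q, hq, hne, rfl⟩ := hsW x hx
        rw [eq_mul_slope_iff (by omega)] at hxeq
        refine ⟨q, hq, ?_⟩
        rw [show k * p - θ * μ = k * i - θ * q by linarith, coeff_subst_image hk.ne']
        exact hne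
      · right
        obtain ⟨-, i, q, hq, hne, rfl⟩ := hsZ x hx
        rw [eq_mul_slope_iff (by omega)] at hxeq
        refine ⟨q, hq, ?_⟩
        rw [show k * DZ - θ * ν = k * i - θ * q by linarith, coeff_subst_image hk.ne']
        exact hne
  · intro hne
    obtain ⟨i, hi, -⟩ := exists_of_coeff_subst_ne_zero hk.ne' hne
    have hmu := h.mu_pos
    rw [Nat.cast_sub hmu] at hi
    exact hk1 (p - i) (by push_cast at hi; linarith)

/-- The descent from a chart in which `μ` and `ν` are orders of vanishing at `y = 0`. It ends because
`μ` and `ν` never increase, and as long as they do not change, no root of `t` is extracted, so that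
the positive integer `d * p - DZ` drops. -/
theorem Stage.false_of_order (hab : a.Coprime b) (had : a ∣ d) (s l : ℕ) :
    ∀ (μ ν : ℕ) (p DZ DG E : ℤ) (F G W Z : Chart), Stage a b d μ ν p DZ DG E F G W Z →
      DZ < d * p → (∀ q < μ, (W.coeff p).coeff q = 0) → (W.coeff p).coeff μ ≠ 0 →
      (∀ q < ν, (Z.coeff DZ).coeff q = 0) → (Z.coeff DZ).coeff ν ≠ 0 →
      μ + ν = s → (d * p - DZ).toNat = l → False := by
  induction s using Nat.strong_induction_on generalizing l with
  | _ s ihs =>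
  induction l using Nat.strong_induction_on with
  | _ l ihl =>
  intro μ ν p DZ DG E F G W Z h hlt hWlow hWμ hZlow hZν hs hl
  obtain ⟨k, θ, p', DZ', DG', E', F', G', W', Z', h', hWd, hZd, hW0, hZ0, hθ, hp', hDZ', hedge,
    hk⟩ := h.exists_subst hlt hWlow hWμ hZlow hZν
  have hne := h'.not_eq hab had hWd hZd hZ0
  have hlt' : DZ' < d * p' := lt_of_le_of_ne h'.le hne
  obtain ⟨r, hr, hle⟩ := exists_root_rootMultiplicity_le (w := W'.coeff p') (z := Z'.coeff DZ')
    (by rw [hWd]; exact h.mu_pos)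
  rw [hWd, hZd] at hle
  set μ' := (W'.coeff p').rootMultiplicity r with hμ'
  set ν' := (Z'.coeff DZ').rootMultiplicity r with hν'
  have hμle : μ' ≤ μ := hWd ▸ rootMultiplicity_le_natDegree _ r
  have hνle : ν' ≤ ν := hZd ▸ rootMultiplicity_le_natDegree _ r
  have h'' := h'.shift r hr hμle hle
  have key : ¬ (μ' + ν' < s ∨ (μ' + ν' = s ∧ (d * p' - DZ').toNat < l)) := by
    rintro (hlt1 | ⟨heq, hlt1⟩)
    · exact ihs _ hlt1 _ μ' ν' p' DZ' DG' E' _ _ _ _ h'' hlt'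
        (fun q hq => coeff_taylor_of_lt_rootMultiplicity hq) (coeff_taylor_rootMultiplicity hW0 r)
        (fun q hq => coeff_taylor_of_lt_rootMultiplicity hq) (coeff_taylor_rootMultiplicity hZ0 r)
        rfl rfl
    · exact ihl _ hlt1 μ' ν' p' DZ' DG' E' _ _ _ _ h'' hlt'
        (fun q hq => coeff_taylor_of_lt_rootMultiplicity hq) (coeff_taylor_rootMultiplicity hW0 r)
        (fun q hq => coeff_taylor_of_lt_rootMultiplicity hq) (coeff_taylor_rootMultiplicity hZ0 r)
        heq rfl
  apply key
  rcases (show μ' + ν' ≤ s by omega).lt_or_eq with h1 | h1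
  · exact Or.inl h1
  refine Or.inr ⟨h1, ?_⟩
  have hμeq : μ' = μ := by omega
  have hνeq : ν' = ν := by omega
  have hWeq := eq_of_rootMultiplicity_eq_natDegree (hμ'.symm.trans (hμeq.trans hWd.symm))
  have hZeq := eq_of_rootMultiplicity_eq_natDegree (hν'.symm.trans (hνeq.trans hZd.symm))
  rw [hWd] at hWeq
  rw [hZd] at hZeq
  -- At `r = 0` there would have been no edge.
  have hr0 : r ≠ 0 := by
    rintro rfl
    rw [Polynomial.C_0, sub_zero] at hWeq hZeq
    rcases hedge with h2 | ⟨q, hq, h2⟩ | ⟨q, hq, h2⟩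
    · exact hne h2
    · rw [hWeq, coeff_C_mul_X_pow, if_neg hq.ne] at h2
      exact h2 rfl
    · rw [hZeq, coeff_C_mul_X_pow, if_neg hq.ne] at h2
      exact h2 rfl
  have hk1 : k = 1 := by
    apply hk
    have hmu := h.mu_pos
    rw [hWeq, coeff_C_mul, sub_eq_add_neg, ← C_neg, coeff_X_add_C_pow]
    refine mul_ne_zero (leadingCoeff_ne_zero.2 hW0) (mul_ne_zero
      (pow_ne_zero _ (neg_ne_zero.2 hr0)) ?_)
    exact_mod_cast (Nat.choose_pos (Nat.sub_le _ _)).ne'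
  subst hk1
  have hMν := h.lt_int
  have : 0 < θ * (d * μ - ν) := mul_pos hθ (by linarith)
  have e : d * p' - DZ' = d * p - DZ - θ * (d * μ - ν) := by rw [hp', hDZ']; ring
  omega

/-- There is no stage in which `μ` and `ν` are the degrees of the leading coefficients. -/
theorem Stage.false_of_natDegree (h : Stage a b d μ ν p DZ DG E F G W Z) (hab : a.Coprime b)
    (had : a ∣ d) (hW : (W.coeff p).natDegree = μ) (hZ : (Z.coeff DZ).natDegree = ν)
    (hZ0 : Z.coeff DZ ≠ 0) : False := by
  have hlt : DZ < d * p := lt_of_le_of_ne h.le (h.not_eq hab had hW hZ hZ0)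
  have hW0 : W.coeff p ≠ 0 := by
    intro h0
    rw [h0, natDegree_zero] at hW
    have := h.mu_pos
    omega
  obtain ⟨r, hr, hle⟩ := exists_root_rootMultiplicity_le (w := W.coeff p) (z := Z.coeff DZ)
    (by rw [hW]; exact h.mu_pos)
  rw [hW, hZ] at hle
  have h' := h.shift r hr (hW ▸ rootMultiplicity_le_natDegree _ r) hle
  exact Stage.false_of_order hab had _ _ _ _ _ _ _ _ _ _ _ _ h' hlt
    (fun q hq => coeff_taylor_of_lt_rootMultiplicity hq) (coeff_taylor_rootMultiplicity hW0 r)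
    (fun q hq => coeff_taylor_of_lt_rootMultiplicity hq) (coeff_taylor_rootMultiplicity hZ0 r)
    rfl rfl

end Chart

/-! ### The chart of the original coordinates -/

theorem exponent_eq {i j : Fin 2} (hij : i ≠ j) (s : Fin 2 →₀ ℕ) :
    s = Finsupp.single i (s i) + Finsupp.single j (s j) := by
  ext l
  have : l = i ∨ l = j := by omega
  rcases this with rfl | rfl
  · simp [hij.symm]
  · simp [hij]

theorem exponent_eq_iff {i j : Fin 2} (hij : i ≠ j) (s : Fin 2 →₀ ℕ) (e q : ℕ) :
    s = Finsupp.single i e + Finsupp.single j q ↔ s i = e ∧ s j = q := by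
  constructor
  · rintro rfl
    simp [hij, hij.symm]
  · rintro ⟨rfl, rfl⟩
    exact exponent_eq hij s

/-- The embedding of `ℂ[x, y]` in `ℂ[y][t, t⁻¹]` which sends the variable `i` to `t` and the other one
to `y`. -/
def toChart (i : Fin 2) : Poly →ₐ[ℂ] Chart :=
  MvPolynomial.aeval fun j =>
    if j = i then AddMonoidAlgebra.single 1 1 else AddMonoidAlgebra.single 0 X

theorem toChart_monomial {i j : Fin 2} (hij : i ≠ j) (s : Fin 2 →₀ ℕ) (c : ℂ) :
    toChart i (MvPolynomial.monomial s c) =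
      AddMonoidAlgebra.single (s i : ℤ) (monomial (s j) c) := by
  have hprod : ∀ f : Fin 2 → Chart, ∏ l, f l = f i * f j := by
    intro f
    rw [Fin.prod_univ_two]
    have : i = 0 ∧ j = 1 ∨ i = 1 ∧ j = 0 := by omega
    rcases this with ⟨rfl, rfl⟩ | ⟨rfl, rfl⟩
    · rfl
    · exact mul_comm _ _
  rw [toChart, MvPolynomial.aeval_monomial, Finsupp.prod_fintype _ _ (by simp), hprod]
  rw [if_pos rfl, if_neg hij.symm, AddMonoidAlgebra.single_pow, AddMonoidAlgebra.single_pow,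
    AddMonoidAlgebra.single_mul_single]
  change AddMonoidAlgebra.single 0 (Polynomial.C c) * _ = _
  rw [AddMonoidAlgebra.single_mul_single, one_pow, one_mul, C_mul_X_pow_eq_monomial]
  congr 1
  simp

theorem coeff_toChart {i j : Fin 2} (hij : i ≠ j) (f : Poly) (e q : ℕ) :
    ((toChart i f).coeff e).coeff q =
      MvPolynomial.coeff (Finsupp.single i e + Finsupp.single j q) f := by
  classical
  induction f using MvPolynomial.induction_on' with
  | add f g hf hg =>
    rw [map_add, AddMonoidAlgebra.coeff_add, Finsupp.add_apply, Polynomial.coeff_add, hf, hg,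
      MvPolynomial.coeff_add]
  | monomial s c =>
    rw [toChart_monomial hij, AddMonoidAlgebra.coeff_single, Finsupp.single_apply,
      MvPolynomial.coeff_monomial]
    simp only [exponent_eq_iff hij, Nat.cast_inj]
    by_cases h1 : s i = e <;> by_cases h2 : s j = q <;> simp [h1, h2, coeff_monomial]

theorem coeff_toChart_of_neg {i j : Fin 2} (hij : i ≠ j) (f : Poly) {e : ℤ} (he : e < 0) :
    (toChart i f).coeff e = 0 := by
  induction f using MvPolynomial.induction_on' with
  | add f g hf hg => rw [map_add, AddMonoidAlgebra.coeff_add, Finsupp.add_apply, hf, hg, add_zero]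
  | monomial s c =>
    rw [toChart_monomial hij, AddMonoidAlgebra.coeff_single, Finsupp.single_apply,
      if_neg (by omega)]

theorem exists_of_coeff_toChart_ne_zero {i j : Fin 2} (hij : i ≠ j) {f : Poly} {e : ℤ} {q : ℕ}
    (h : ((toChart i f).coeff e).coeff q ≠ 0) :
    ∃ s : Fin 2 →₀ ℕ, MvPolynomial.coeff s f ≠ 0 ∧ (s i : ℤ) = e ∧ s j = q := by
  have he : 0 ≤ e := by
    by_contra! he
    exact h (by rw [coeff_toChart_of_neg hij f he, coeff_zero])
  lift e to ℕ using he
  rw [coeff_toChart hij] at h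
  exact ⟨_, h, by simp [hij.symm], by simp [hij]⟩

theorem euler_toChart {i j : Fin 2} (hij : i ≠ j) (f : Poly) :
    Chart.euler (toChart i f) =
      AddMonoidAlgebra.single 1 1 * toChart i (MvPolynomial.pderiv i f) := by
  have hadd : ∀ f g : Chart, Chart.euler (f + g) = Chart.euler f + Chart.euler g := by
    intro f g
    ext1; ext1 n
    simp [mul_add]
  induction f using MvPolynomial.induction_on' with
  | add f g hf hg => rw [map_add, hadd, hf, hg, map_add, map_add, mul_add]
  | monomial s c =>
    rw [MvPolynomial.pderiv_monomial, toChart_monomial hij, toChart_monomial hij,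
      AddMonoidAlgebra.single_mul_single]
    apply Chart.ext₂
    intro e q
    rw [Chart.coeff_euler, AddMonoidAlgebra.coeff_single, AddMonoidAlgebra.coeff_single,
      Finsupp.single_apply, Finsupp.single_apply, ← Polynomial.C_eq_intCast, coeff_C_mul]
    simp only [Finsupp.coe_tsub, Pi.sub_apply, Finsupp.single_eq_same, one_mul,
      Finsupp.single_apply, if_neg hij, tsub_zero]
    rcases Nat.eq_zero_or_pos (s i) with h0 | hpos
    · rw [h0]
      by_cases he : (0 : ℤ) = e
      · subst he; simp
      · simp [he]
    · have hcast : (1 : ℤ) + ((s i - 1 : ℕ) : ℤ) = s i := by omega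
      rw [hcast]
      by_cases he : (s i : ℤ) = e
      · rw [if_pos he, if_pos he, coeff_monomial, coeff_monomial, ← he]
        split_ifs
        · push_cast; ring
        · simp
      · rw [if_neg he, if_neg he]; simp

theorem dY_toChart {i j : Fin 2} (hij : i ≠ j) (f : Poly) :
    Chart.dY (toChart i f) = toChart i (MvPolynomial.pderiv j f) := by
  have hadd : ∀ f g : Chart, Chart.dY (f + g) = Chart.dY f + Chart.dY g := by
    intro f g
    ext1; ext1 n
    simp
  induction f using MvPolynomial.induction_on' with
  | add f g hf hg => rw [map_add, hadd, hf, hg, map_add, map_add]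
  | monomial s c =>
    rw [MvPolynomial.pderiv_monomial, toChart_monomial hij, toChart_monomial hij]
    ext1; ext1 n
    rw [Chart.coeff_dY, AddMonoidAlgebra.coeff_single, AddMonoidAlgebra.coeff_single,
      Finsupp.single_apply, Finsupp.single_apply]
    simp only [Finsupp.coe_tsub, Pi.sub_apply, Finsupp.single_eq_same,
      Finsupp.single_apply, if_neg hij.symm, tsub_zero]
    split_ifs <;> simp [derivative_monomial]

theorem bracket_toChart {i j : Fin 2} (hij : i ≠ j) (f g : Poly) :
    Chart.bracket (toChart i f) (toChart i g) = AddMonoidAlgebra.single 1 1 *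
      toChart i (MvPolynomial.pderiv i f * MvPolynomial.pderiv j g -
        MvPolynomial.pderiv i g * MvPolynomial.pderiv j f) := by
  simp only [Chart.bracket, euler_toChart hij, dY_toChart hij, map_sub, map_mul]
  ring

theorem degLE_toChart {i j : Fin 2} (hij : i ≠ j) {f : Poly} {D : ℕ}
    (h : ∀ s, MvPolynomial.coeff s f ≠ 0 → s i ≤ D) : Chart.DegLE (toChart i f) D := by
  intro e he
  ext q
  rw [coeff_zero]
  by_contra hne
  obtain ⟨s, hs, h1, -⟩ := exists_of_coeff_toChart_ne_zero hij hne
  have := h s hs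
  omega

theorem natDegree_toChart {i j : Fin 2} (hij : i ≠ j) {f : Poly} {D N : ℕ}
    (h : ∀ s, MvPolynomial.coeff s f ≠ 0 → s i = D → s j ≤ N)
    (hne : MvPolynomial.coeff (Finsupp.single i D + Finsupp.single j N) f ≠ 0) :
    ((toChart i f).coeff D).natDegree = N := by
  refine le_antisymm ?_ (le_natDegree_of_ne_zero (by rwa [coeff_toChart hij]))
  rw [natDegree_le_iff_coeff_eq_zero]
  intro q hq
  by_contra hcon
  obtain ⟨s, hs, h1, h2⟩ := exists_of_coeff_toChart_ne_zero hij hcon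
  have := h s hs (by exact_mod_cast h1)
  omega

theorem toChart_coeff_ne_zero {i j : Fin 2} (hij : i ≠ j) {f : Poly} {D N : ℕ}
    (hne : MvPolynomial.coeff (Finsupp.single i D + Finsupp.single j N) f ≠ 0) :
    (toChart i f).coeff D ≠ 0 := by
  intro h0
  rw [← coeff_toChart hij, h0, coeff_zero] at hne
  exact hne rfl

/-- The constraint on the vertex `(D, N)` of `Z` which is highest among the rightmost ones, when
variable `i` is the horizontal one: this vertex cannot be of small height and lie both below the
diagonal and below the line from the corner of `F` to `a / (a + b) • (1, 1)`. -/
theorem false_of_vertex {i j : Fin 2} (hij : i ≠ j) {a b d p μ D N g g' : ℕ} {F G W Z : Poly}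
    {P : ℂ[X]} {c : ℂ} (hab : a.Coprime b) (had : a ∣ d) (hP : P.Monic) (hPd : P.natDegree = d)
    (hF : F = aeval W P + Z)
    (hW : ∀ s, MvPolynomial.coeff s W ≠ 0 → s i ≤ p ∧ s j ≤ μ)
    (hWne : MvPolynomial.coeff (Finsupp.single i p + Finsupp.single j μ) W ≠ 0)
    (hG : ∀ s, MvPolynomial.coeff s G ≠ 0 → s i ≤ g)
    (hGne : MvPolynomial.coeff (Finsupp.single i g + Finsupp.single j g') G ≠ 0)
    (hag : a * g = b * (d * p))
    (hZ : ∀ s, MvPolynomial.coeff s Z ≠ 0 → s i ≤ D ∧ (s i = D → s j ≤ N))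
    (hZne : MvPolynomial.coeff (Finsupp.single i D + Finsupp.single j N) Z ≠ 0)
    (hJ : MvPolynomial.pderiv i F * MvPolynomial.pderiv j G -
        MvPolynomial.pderiv i G * MvPolynomial.pderiv j F = MvPolynomial.C c)
    (hle : D ≤ d * p) (hratio : a * N < (a - 1) * (d * μ)) (hpos : N * (d * p) < d * μ * D)
    (hline : (a : ℤ) * ((d * μ - N) - (d * p - D)) <
      (a + b) * ((d : ℤ) * μ * D - N * (d * p))) : False := by
  have hst : Chart.Stage a b d μ N (p : ℤ) D g 1 (toChart i F) (toChart i G) (toChart i W)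
      (toChart i Z) :=
    { rel := ⟨P, hP, hPd, by rw [hF, map_add, ← aeval_algHom_apply]⟩
      degW := degLE_toChart hij fun s hs => (hW s hs).1
      degZ := degLE_toChart hij fun s hs => (hZ s hs).1
      le := by exact_mod_cast hle
      ratio := hratio
      pos := by exact_mod_cast hpos
      line := by rwa [one_mul]
      degG := degLE_toChart hij hG
      topG := toChart_coeff_ne_zero hij hGne
      hDG := by exact_mod_cast hag
      jac := by
        refine ⟨c, ?_⟩
        rw [bracket_toChart hij, hJ]
        change _ * toChart i (algebraMap ℂ Poly c) = _
        rw [AlgHom.commutes]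
        change _ * AddMonoidAlgebra.single 0 (Polynomial.C c) = _
        rw [AddMonoidAlgebra.single_mul_single, one_mul, add_zero] }
  exact hst.false_of_natDegree hab had
    (natDegree_toChart hij (fun s hs _ => (hW s hs).2) hWne)
    (natDegree_toChart hij (fun s hs => (hZ s hs).2) hZne) (toChart_coeff_ne_zero hij hZne)

/-! ### Newton polygons and rectangles -/

theorem rect_eq (m n : ℕ) : rect m n = Set.Icc (0 : ℝ) m ×ˢ Set.Icc (0 : ℝ) n := by
  have h : ({((0 : ℝ), (0 : ℝ)), ((m : ℝ), (0 : ℝ)), ((m : ℝ), (n : ℝ)), ((0 : ℝ), (n : ℝ))} :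
      Set (ℝ × ℝ)) = {(0 : ℝ), (m : ℝ)} ×ˢ {(0 : ℝ), (n : ℝ)} := by
    ext ⟨x, y⟩
    simp only [Set.mem_insert_iff, Set.mem_singleton_iff, Set.mem_prod, Prod.mk.injEq]
    tauto
  rw [rect, h, convexHull_prod, convexHull_pair, convexHull_pair,
    segment_eq_Icc (Nat.cast_nonneg _), segment_eq_Icc (Nat.cast_nonneg _)]

theorem expo_eq (s : Fin 2 →₀ ℕ) : expo (s 0) (s 1) = s :=
  (exponent_eq (by decide : (0 : Fin 2) ≠ 1) s).symm

theorem mem_supp {f : Poly} {s : Fin 2 →₀ ℕ} (h : MvPolynomial.coeff s f ≠ 0) :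
    ((s 0 : ℝ), (s 1 : ℝ)) ∈ supp f :=
  ⟨s 0, s 1, by rwa [expo_eq], rfl⟩

theorem le_of_newton0_subset {f : Poly} {m n : ℕ} (hf : newton0 f ⊆ rect m n) {s : Fin 2 →₀ ℕ}
    (h : MvPolynomial.coeff s f ≠ 0) : s 0 ≤ m ∧ s 1 ≤ n := by
  have := hf (subset_convexHull ℝ _ (Or.inl (mem_supp h)))
  rw [rect_eq] at this
  exact ⟨Nat.cast_le.1 this.1.2, Nat.cast_le.1 this.2.2⟩

theorem newton0_subset {f : Poly} {m n : ℕ}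
    (h : ∀ s, MvPolynomial.coeff s f ≠ 0 → s 0 ≤ m ∧ s 1 ≤ n) : newton0 f ⊆ rect m n := by
  rw [rect_eq]
  refine convexHull_min ?_ ((convex_Icc _ _).prod (convex_Icc _ _))
  rintro _ (⟨i, j, hne, rfl⟩ | rfl)
  · have := h _ hne
    simp only [expo, Finsupp.add_apply, Finsupp.single_apply, if_true, one_ne_zero, zero_ne_one,
      if_false, add_zero, zero_add] at this
    exact ⟨⟨Nat.cast_nonneg _, Nat.cast_le.2 this.1⟩, ⟨Nat.cast_nonneg _, Nat.cast_le.2 this.2⟩⟩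
  · exact ⟨⟨le_rfl, Nat.cast_nonneg _⟩, ⟨le_rfl, Nat.cast_nonneg _⟩⟩

/-- The lattice points of the rectangle which avoid its upper right corner `𝒩''`. -/
theorem bounds_of_supp_subset {f F : Poly} {a m n : ℕ} (ha : 0 < a) (ham : a ∣ m) (han : a ∣ n)
    (hF : newton0 F ⊆ rect m n) (h : supp f ⊆ newton0 F \ innerCorner a m n) {s : Fin 2 →₀ ℕ}
    (hs : MvPolynomial.coeff s f ≠ 0) :
    (s 0 ≤ m ∧ s 1 ≤ n) ∧ ¬ ((a - 1) * (m / a) ≤ s 0 ∧ (a - 1) * (n / a) ≤ s 1) := by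
  obtain ⟨h1, h2⟩ := h (mem_supp hs)
  have h3 := hF h1
  rw [rect_eq] at h3
  have hm : s 0 ≤ m := Nat.cast_le.1 h3.1.2
  have hn : s 1 ≤ n := Nat.cast_le.1 h3.2.2
  refine ⟨⟨hm, hn⟩, ?_⟩
  rintro ⟨h4, h5⟩
  obtain ⟨m, rfl⟩ := ham
  obtain ⟨n, rfl⟩ := han
  rw [Nat.mul_div_cancel_left _ ha] at h4 h5
  apply h2
  have ha' : (a : ℝ) ≠ 0 := Nat.cast_ne_zero.2 ha.ne'
  refine ⟨(s 0 - (a - 1) * m, s 1 - (a - 1) * n), ?_, ?_⟩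
  · rw [rect_eq, Nat.mul_div_cancel_left _ ha, Nat.mul_div_cancel_left _ ha]
    have h4' : ((a - 1 : ℕ) : ℝ) * m ≤ s 0 := by exact_mod_cast h4
    have h5' : ((a - 1 : ℕ) : ℝ) * n ≤ s 1 := by exact_mod_cast h5
    have hm' : (s 0 : ℝ) ≤ a * m := by exact_mod_cast hm
    have hn' : (s 1 : ℝ) ≤ a * n := by exact_mod_cast hn
    rw [Nat.cast_sub ha, Nat.cast_one] at h4' h5'
    refine ⟨⟨?_, ?_⟩, ⟨?_, ?_⟩⟩ <;> simp only <;> linarith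
  · ext
    · simp
      field_simp
      ring
    · simp
      field_simp
      ring

/-- A polynomial `Q` with leading monomial `x ^ m y ^ n` is determined by the upper right corner of
`Q ^ a`. -/
theorem eq_of_pow_sub_pow {Q Q' : Poly} {a m n : ℕ} (ha : 0 < a)
    (hQ : ∀ s, MvPolynomial.coeff s Q ≠ 0 → s 0 ≤ m ∧ s 1 ≤ n)
    (hQ' : ∀ s, MvPolynomial.coeff s Q' ≠ 0 → s 0 ≤ m ∧ s 1 ≤ n)
    (h1 : MvPolynomial.coeff (expo m n) Q = 1) (h1' : MvPolynomial.coeff (expo m n) Q' = 1)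
    (h : ∀ s, MvPolynomial.coeff s (Q ^ a - Q' ^ a) ≠ 0 →
      ¬ ((a - 1) * m ≤ s 0 ∧ (a - 1) * n ≤ s 1)) : Q = Q' := by
  have hij : (0 : Fin 2) ≠ 1 := by decide
  by_contra hne
  have hD : toChart 0 (Q - Q') ≠ 0 := by
    intro h0
    apply hne
    rw [← sub_eq_zero]
    ext s
    rw [exponent_eq hij s, ← coeff_toChart hij, h0]
    simp
  have hnot : ¬ Chart.DegLE (toChart 0 (Q - Q')) (-1) := by
    intro hle
    apply hD
    rw [← AddMonoidAlgebra.coeff_eq_zero]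
    refine Finsupp.ext fun e => ?_
    rcases lt_or_ge e 0 with he | he
    · exact coeff_toChart_of_neg hij _ he
    · exact hle e (by omega)
  obtain ⟨D, hD0, hDle, hDne⟩ := Chart.exists_degLE hnot
  have hmonic : ∀ Q : Poly, (∀ s, MvPolynomial.coeff s Q ≠ 0 → s 0 ≤ m ∧ s 1 ≤ n) →
      MvPolynomial.coeff (expo m n) Q = 1 → Chart.DegLE (toChart 0 Q) m ∧
        ((toChart 0 Q).coeff m).natDegree = n ∧ ((toChart 0 Q).coeff m).Monic := by
    intro Q hQ h1
    have h2 : ((toChart 0 Q).coeff m).natDegree = n :=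
      natDegree_toChart hij (fun s hs _ => (hQ s hs).2) (by
        change MvPolynomial.coeff (expo m n) Q ≠ 0
        rw [h1]; exact one_ne_zero)
    refine ⟨degLE_toChart hij fun s hs => (hQ s hs).1, h2, ?_⟩
    rw [Monic, leadingCoeff, h2, coeff_toChart hij]
    exact h1
  obtain ⟨hq, hqd, hqm⟩ := hmonic Q hQ h1
  obtain ⟨hq', hqd', hqm'⟩ := hmonic Q' hQ' h1'
  set S : Chart := ∑ k ∈ Finset.range a, toChart 0 Q ^ k * toChart 0 Q' ^ (a - 1 - k)
  have hterm : ∀ k ∈ Finset.range a,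
      Chart.DegLE (toChart 0 Q ^ k * toChart 0 Q' ^ (a - 1 - k)) ((a - 1 : ℕ) * m) ∧
      ((toChart 0 Q ^ k * toChart 0 Q' ^ (a - 1 - k)).coeff ((a - 1 : ℕ) * m)).natDegree ≤
        (a - 1) * n ∧
      ((toChart 0 Q ^ k * toChart 0 Q' ^ (a - 1 - k)).coeff ((a - 1 : ℕ) * m)).coeff
        ((a - 1) * n) = 1 := by
    intro k hk
    have hk' : k + (a - 1 - k) = a - 1 := by
      have := Finset.mem_range.1 hk
      omega
    have e : ((a - 1 : ℕ) : ℤ) * m = k * m + (a - 1 - k : ℕ) * m := by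
      rw [← add_mul, ← Nat.cast_add, hk']
    have hc : (toChart 0 Q ^ k * toChart 0 Q' ^ (a - 1 - k)).coeff ((a - 1 : ℕ) * m) =
        (toChart 0 Q).coeff m ^ k * (toChart 0 Q').coeff m ^ (a - 1 - k) := by
      rw [e, (hq.pow k).coeff_mul (hq'.pow _), hq.coeff_pow, hq'.coeff_pow]
    have hd : ((toChart 0 Q).coeff m ^ k * (toChart 0 Q').coeff m ^ (a - 1 - k)).natDegree =
        (a - 1) * n := by
      rw [(hqm.pow k).natDegree_mul (hqm'.pow _), hqm.natDegree_pow, hqm'.natDegree_pow, hqd, hqd',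
        ← add_mul, hk']
    refine ⟨e ▸ (hq.pow k).mul (hq'.pow _), by rw [hc, hd], ?_⟩
    rw [hc, ← hd]
    exact ((hqm.pow k).mul (hqm'.pow _)).coeff_natDegree
  have hS : Chart.DegLE S ((a - 1 : ℕ) * m) := Chart.DegLE.sum fun k hk => (hterm k hk).1
  have hSc : S.coeff ((a - 1 : ℕ) * m) = ∑ k ∈ Finset.range a,
      (toChart 0 Q ^ k * toChart 0 Q' ^ (a - 1 - k)).coeff ((a - 1 : ℕ) * m) := by
    rw [AddMonoidAlgebra.coeff_sum, Finset.sum_apply']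
  have hSd : (S.coeff ((a - 1 : ℕ) * m)).natDegree ≤ (a - 1) * n := by
    rw [hSc]
    exact natDegree_sum_le_of_forall_le _ _ fun k hk => (hterm k hk).2.1
  have hS1 : (S.coeff ((a - 1 : ℕ) * m)).coeff ((a - 1) * n) = a := by
    rw [hSc, finsetSum_coeff, Finset.sum_congr rfl fun k hk => (hterm k hk).2.2]
    simp
  have hfac : S * toChart 0 (Q - Q') = toChart 0 (Q ^ a - Q' ^ a) := by
    rw [map_sub, map_sub, map_pow, map_pow]
    exact (Commute.all _ _).geom_sum₂_mul a
  set J := ((toChart 0 (Q - Q')).coeff D).natDegree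
  have hprod : ((toChart 0 (Q ^ a - Q' ^ a)).coeff ((a - 1 : ℕ) * m + D)).coeff
      ((a - 1) * n + J) ≠ 0 := by
    rw [← hfac, hS.coeff_mul hDle, coeff_mul_add_eq_of_natDegree_le hSd le_rfl, hS1]
    exact mul_ne_zero (Nat.cast_ne_zero.2 ha.ne') (leadingCoeff_ne_zero.2 hDne)
  obtain ⟨s, hs, hs0, hs1⟩ := exists_of_coeff_toChart_ne_zero hij hprod
  refine h s hs ⟨?_, ?_⟩
  · have : (((a - 1) * m : ℕ) : ℤ) = (a - 1 : ℕ) * m := by push_cast; ring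
    omega
  · omega

theorem bounds_pow {W : Poly} {p q : ℕ} (hW : ∀ s, MvPolynomial.coeff s W ≠ 0 → s 0 ≤ p ∧ s 1 ≤ q)
    (k : ℕ) {s : Fin 2 →₀ ℕ} (hs : MvPolynomial.coeff s (W ^ k) ≠ 0) :
    s 0 ≤ k * p ∧ s 1 ≤ k * q := by
  have key : ∀ (l : Fin 2) (B : ℕ), (∀ s, MvPolynomial.coeff s W ≠ 0 → s l ≤ B) →
      s l ≤ k * B := by
    intro l B hB
    have h1 : MvPolynomial.degreeOf l W ≤ B :=
      MvPolynomial.degreeOf_le_iff.2 fun s hs => hB s (MvPolynomial.mem_support_iff.1 hs)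
    have h2 := MvPolynomial.degreeOf_le_iff.1 (MvPolynomial.degreeOf_pow_le l W k) s
      (MvPolynomial.mem_support_iff.2 hs)
    exact h2.trans (Nat.mul_le_mul_left _ h1)
  exact ⟨key 0 p fun s hs => (hW s hs).1, key 1 q fun s hs => (hW s hs).2⟩

/-! ### The position of the vertices -/

/-- The EN vertex, in terms of exponents. -/
theorem exists_EN {f : Poly} (hf : f ≠ 0) : ∃ i j : ℕ, MvPolynomial.coeff (expo i j) f ≠ 0 ∧
    ∀ s, MvPolynomial.coeff s f ≠ 0 → s 0 ≤ i ∧ (s 0 = i → s 1 ≤ j) := by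
  obtain ⟨s, hs, hmax⟩ := f.support.exists_max_image (fun s => toLex (s 0, s 1))
    (MvPolynomial.support_nonempty.2 hf)
  refine ⟨s 0, s 1, by rw [expo_eq]; exact MvPolynomial.mem_support_iff.1 hs, fun t ht => ?_⟩
  have := hmax t (MvPolynomial.mem_support_iff.2 ht)
  rw [Prod.Lex.le_iff] at this
  simp only [ofLex_toLex] at this
  omega

/-- The NE vertex, in terms of exponents. -/
theorem exists_NE {f : Poly} (hf : f ≠ 0) : ∃ i j : ℕ, MvPolynomial.coeff (expo i j) f ≠ 0 ∧
    ∀ s, MvPolynomial.coeff s f ≠ 0 → s 1 ≤ j ∧ (s 1 = j → s 0 ≤ i) := by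
  obtain ⟨s, hs, hmax⟩ := f.support.exists_max_image (fun s => toLex (s 1, s 0))
    (MvPolynomial.support_nonempty.2 hf)
  refine ⟨s 0, s 1, by rw [expo_eq]; exact MvPolynomial.mem_support_iff.1 hs, fun t ht => ?_⟩
  have := hmax t (MvPolynomial.mem_support_iff.2 ht)
  rw [Prod.Lex.le_iff] at this
  simp only [ofLex_toLex] at this
  omega

/-- The constraints on the EN vertex `(m₁, n₁)` and the NE vertex `(m₂, n₂)` leave room for a single
point: the part of the region between the diagonal and the line through `C` has no room for a segment
of negative slope between lattice points. -/
theorem vertices_coincide {a b m n m₁ n₁ m₂ n₂ : ℤ} (ha : 0 < a) (hab : a < b) (hm : 0 < m)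
    (hmn : m ≤ n) (hm₁ : m₁ ≤ m) (hn₂ : n₂ ≤ n) (hn₂0 : 0 ≤ n₂) (hm₂ : m₂ ≤ m₁) (hn₁ : n₁ ≤ n₂)
    (hEN : n₁ = n₂ → m₁ ≤ m₂) (hNE : m₁ = m₂ → n₂ ≤ n₁) (hm₂0 : 0 ≤ m₂)
    (hout₁ : ¬ ((a - 1) * m ≤ a * m₁ ∧ (a - 1) * n ≤ a * n₁))
    (hout₂ : ¬ ((a - 1) * m ≤ a * m₂ ∧ (a - 1) * n ≤ a * n₂))
    (h₁ : a * n₁ < (a - 1) * n → n₁ * m < n * m₁ →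
      (a + b) * (n * m₁ - n₁ * m) ≤ a * ((n - n₁) - (m - m₁)))
    (h₂ : a * m₂ < (a - 1) * m → m₂ * n < m * n₂ →
      (a + b) * (m * n₂ - m₂ * n) ≤ a * ((m - m₂) - (n - n₂))) :
    m₁ = m₂ ∧ n₁ = n₂ ∧ a * n₁ < (a - 1) * n ∧
      (a + b) * (n * m₁ - n₁ * m) ≤ a * ((n - n₁) - (m - m₁)) ∧ m * n₁ ≤ m₁ * n := by
  have hn : 0 < n := by omega
  -- The NE vertex lies on or below the diagonal when its abscissa is small.
  have h₂' : a * m₂ < (a - 1) * m → m * n₂ ≤ m₂ * n := by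
    intro hs
    by_contra! hlt
    have h3 := h₂ hs hlt
    have h4 : a * ((m - m₂) - (n - n₂)) ≤ a * (m * n₂ - m₂ * n) := by
      apply mul_le_mul_of_nonneg_left _ ha.le
      rcases le_total (m - m₂) (n - n₂) with h5 | h5
      · linarith
      · have h6 : (0 : ℤ) ≤ (n - m) * (m - m₂) := mul_nonneg (by omega) (by omega)
        have h7 : (0 : ℤ) ≤ (m - 1) * ((m - m₂) - (n - n₂)) := mul_nonneg (by omega) (by omega)
        linarith
    have h5 : 0 < b * (m * n₂ - m₂ * n) := mul_pos (by omega) (by omega)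
    linarith
  have hsmall : a * n₁ < (a - 1) * n := by
    by_contra! hge
    have h3 : a * m₁ < (a - 1) * m := by
      by_contra! h
      exact hout₁ ⟨h, hge⟩
    have h4 : a * m₂ < (a - 1) * m := lt_of_le_of_lt (mul_le_mul_of_nonneg_left hm₂ ha.le) h3
    have h5 := mul_le_mul_of_nonneg_left (h₂' h4) ha.le
    have h6 := mul_lt_mul_of_pos_right h4 hn
    have h7 := mul_le_mul_of_nonneg_right
      (hge.trans (mul_le_mul_of_nonneg_left hn₁ ha.le)) hm.le
    linarith
  have hline : (a + b) * (n * m₁ - n₁ * m) ≤ a * ((n - n₁) - (m - m₁)) := by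
    rcases lt_or_ge (n₁ * m) (n * m₁) with h | h
    · exact h₁ hsmall h
    · -- On or above the diagonal, the line through `C` has been crossed as well.
      by_contra! hlt
      have h3 : b * (n * m₁ - n₁ * m) ≤ 0 :=
        mul_nonpos_of_nonneg_of_nonpos (by omega) (by omega)
      have h4 : a * ((n - n₁) - (m - m₁)) < a * (n * m₁ - n₁ * m) := by linarith
      have h5 := lt_of_mul_lt_mul_left h4 ha.le
      have h6 : 0 ≤ (n - m) * (m - m₁) := mul_nonneg (by omega) (by omega)
      have h7 : 0 ≤ (m - 1) * ((m - m₁) - (n - n₁)) := mul_nonneg (by omega) (by omega)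
      linarith
  have hdiag : m * n₂ ≤ m₂ * n := by
    rcases lt_or_ge (a * m₂) ((a - 1) * m) with h | h
    · exact h₂' h
    · have h3 : a * n₂ < (a - 1) * n := by
        by_contra! h'
        exact hout₂ ⟨h, h'⟩
      have h4 := mul_lt_mul_of_pos_left h3 hm
      have h5 := mul_le_mul_of_nonneg_right h hn.le
      have : a * (m * n₂) ≤ a * (m₂ * n) := by linarith
      exact le_of_mul_le_mul_left this ha
  have heq : m₁ = m₂ := by
    by_contra hne
    have h3 : m₂ + 1 ≤ m₁ := by omega
    have h4 : n₁ + 1 ≤ n₂ := by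
      by_contra! h
      exact hne (le_antisymm (hEN (by omega)) hm₂)
    have h5 : 0 ≤ ((a + b) * n - a) * (m₁ - m₂ - 1) := by
      apply mul_nonneg _ (by omega)
      nlinarith
    have h6 : 0 ≤ ((a + b) * m - a) * (n₂ - n₁ - 1) := by
      apply mul_nonneg _ (by omega)
      nlinarith
    have h7 : 0 ≤ (a + b) * (m₂ * n - m * n₂) := mul_nonneg (by omega) (by omega)
    have h8 : 0 ≤ a * n₂ := mul_nonneg ha.le hn₂0
    have h9 : 0 ≤ a * (m - m₂) := mul_nonneg ha.le (by omega)
    have h10 : b ≤ b * n := by nlinarith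
    have h11 : a + b ≤ (a + b) * m := by nlinarith
    linarith
  subst heq
  have heq' : n₁ = n₂ := le_antisymm hn₁ (hNE rfl)
  subst heq'
  exact ⟨rfl, rfl, hsmall, hline, hdiag⟩

theorem vertices_of_newton0 {f : Poly} {m n : ℕ} (hf : f ∈ Rbar m n) :
    IsNEVertex (newton0 f) ((m : ℝ), (n : ℝ)) ∧ IsENVertex (newton0 f) ((m : ℝ), (n : ℝ)) := by
  obtain ⟨hsub, hne⟩ := hf
  rw [rect_eq] at hsub
  have hext : ((m : ℝ), (n : ℝ)) ∈ (newton0 f).extremePoints ℝ := by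
    have hmem : ((m : ℝ), (n : ℝ)) ∈ newton0 f :=
      subset_convexHull ℝ _ (Or.inl ⟨m, n, hne, rfl⟩)
    refine inter_extremePoints_subset_extremePoints_of_subset hsub ⟨hmem, ?_⟩
    rw [extremePoints_prod]
    constructor
    · change (m : ℝ) ∈ _
      rw [Set.extremePoints_Icc (Nat.cast_nonneg _)]
      simp
    · change (n : ℝ) ∈ _
      rw [Set.extremePoints_Icc (Nat.cast_nonneg _)]
      simp
  refine ⟨⟨hext, fun q hq => ?_⟩, ⟨hext, fun q hq => ?_⟩⟩
  · have := hsub hq.1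
    rcases this.2.2.lt_or_eq with h | h
    · exact Or.inl h
    · exact Or.inr ⟨h, this.1.2⟩
  · have := hsub hq.1
    rcases this.1.2.lt_or_eq with h | h
    · exact Or.inl h
    · exact Or.inr ⟨h, this.2.2⟩

theorem newton0_zero : newton0 0 = {((0 : ℝ), (0 : ℝ))} := by
  have : supp 0 = ∅ := by
    ext p
    simp [supp]
  rw [newton0, this, Set.empty_union, convexHull_singleton]

theorem monic_outer {β : ℂ[X]} (hβ : β.Monic) {a N : ℕ} (hN : N ≤ a * β.natDegree)
    (e : ℕ → ℂ) :
    (β ^ a + ∑ j ∈ Finset.range N, Polynomial.C (e j) * X ^ j).Monic ∧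
      (β ^ a + ∑ j ∈ Finset.range N, Polynomial.C (e j) * X ^ j).natDegree =
        a * β.natDegree := by
  have hlow : (∑ j ∈ Finset.range N, Polynomial.C (e j) * X ^ j).degree < (β ^ a).degree := by
    rw [degree_eq_natDegree (hβ.pow a).ne_zero, hβ.natDegree_pow]
    refine (degree_sum_le _ _).trans_lt ((Finset.sup_lt_iff (WithBot.bot_lt_coe _)).2 ?_)
    intro j hj
    refine (degree_C_mul_X_pow_le _ _).trans_lt ?_
    exact_mod_cast (Finset.mem_range.1 hj).trans_le hN
  exact ⟨(hβ.pow a).add_of_left hlow, by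
    rw [natDegree_add_eq_left_of_degree_lt hlow, hβ.natDegree_pow]⟩

theorem mem_narrowRegion {a b m n : ℕ} {x y : ℕ} (ha : 0 < a) (hb : 0 < b) (hm : 0 < m)
    (h1 : (a : ℤ) * y < (a - 1) * n)
    (h2 : ((a : ℤ) + b) * (n * x - y * m) ≤ a * ((n - y) - (m - x)))
    (h3 : (m : ℤ) * y ≤ x * n) : ((x : ℝ), (y : ℝ)) ∈ narrowRegion a b m n := by
  have ha' : (0 : ℝ) < a := by exact_mod_cast ha
  have hb' : (0 : ℝ) < b := by exact_mod_cast hb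
  have hm' : (1 : ℝ) ≤ m := by exact_mod_cast hm
  have h1' : (a : ℝ) * y < (a - 1) * n := by exact_mod_cast h1
  have h2' : ((a : ℝ) + b) * (n * x - y * m) ≤ a * ((n - y) - (m - x)) := by exact_mod_cast h2
  have h3' : (m : ℝ) * y ≤ x * n := by exact_mod_cast h3
  have hc : cpt a b < 1 := by
    rw [cpt, div_lt_one (by positivity)]
    linarith
  have hca : (a : ℝ) = cpt a b * (a + b) := by
    rw [cpt, div_mul_cancel₀ _ (by positivity)]
  refine ⟨Nat.cast_nonneg _, ?_, ?_, ?_⟩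
  · change (y : ℝ) < _
    rw [div_mul_eq_mul_div, lt_div_iff₀ ha']
    linarith
  · change slopeC a b m n * ((x : ℝ) - cpt a b) + cpt a b ≤ y
    have hmc : (0 : ℝ) < m - cpt a b := by linarith
    rw [← le_sub_iff_add_le, slopeC, div_mul_eq_mul_div, div_le_iff₀ hmc]
    generalize cpt a b = c at *
    have h5 : ((a : ℝ) + b) * (n * x - y * m) ≤ (a + b) * (c * ((n - y) - (m - x))) := by
      calc _ ≤ _ := h2'
        _ = (c * (a + b)) * ((n - y) - (m - x)) := by rw [← hca]
        _ = _ := by ring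
    have h6 := le_of_mul_le_mul_left h5 (by positivity)
    linarith
  · change (y : ℝ) ≤ _
    rw [div_mul_eq_mul_div, le_div_iff₀ (by linarith)]
    linarith

/-- A nonzero innermost polynomial has its NE and EN vertices at the same point of the narrow
region. -/
theorem innermost_mem_narrowRegion {a b m n : ℕ} (hQ : Admissible a b m n) (hmn : m ≤ n) {F G Z : Poly}
    (hF : F ∈ R m n) (hG : G ∈ R (b * m / a) (b * n / a))
    (hFG : ∃ c : ℂ, jacobian F G = MvPolynomial.C c) (hZ : IsInnermost a m n F Z) (hZ0 : Z ≠ 0) :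
    ∃ m' n' : ℕ, 0 < m' ∧ 0 < n' ∧ Z ∈ Rbar m' n' ∧
      ((m' : ℝ), (n' : ℝ)) ∈ narrowRegion a b m n := by
  obtain ⟨ha, hb, hm, hn, ham, han, hgcd, ha2, hab⟩ := hQ
  obtain ⟨Q, δ, β, W, e, ⟨hQR, hQsupp⟩, ⟨hδm, hδn, -, hWR, hβ, hβδ, hβsupp⟩, hZeq, hZdiag⟩ := hZ
  obtain ⟨c, hc⟩ := hFG
  have hδ : 0 < δ := hβδ ▸ hβ.2.1
  obtain ⟨p, hp⟩ := hδm
  obtain ⟨q, hq⟩ := hδn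
  have hm_eq : m = a * (δ * p) := by rw [← hp, Nat.mul_div_cancel' ham]
  have hn_eq : n = a * (δ * q) := by rw [← hq, Nat.mul_div_cancel' han]
  have hpw : m / (a * δ) = p := by
    rw [hm_eq, ← mul_assoc, Nat.mul_div_cancel_left _ (Nat.mul_pos ha hδ)]
  have hqw : n / (a * δ) = q := by
    rw [hn_eq, ← mul_assoc, Nat.mul_div_cancel_left _ (Nat.mul_pos ha hδ)]
  have hp0 : 0 < p := by
    rcases Nat.eq_zero_or_pos p with h | h
    · rw [hm_eq, h] at hm; simp at hm
    · exact h
  have hq0 : 0 < q := by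
    rcases Nat.eq_zero_or_pos q with h | h
    · rw [hn_eq, h] at hn; simp at hn
    · exact h
  rw [hpw, hqw] at hWR
  have hWb : ∀ s, MvPolynomial.coeff s W ≠ 0 → s 0 ≤ p ∧ s 1 ≤ q :=
    fun s hs => le_of_newton0_subset hWR.1.le hs
  -- `Q` and `β(W)` agree, as each is determined by the upper right corner of `F`.
  set B : Poly := aeval W β with hB
  have hBb : ∀ s, MvPolynomial.coeff s B ≠ 0 → s 0 ≤ m / a ∧ s 1 ≤ n / a := by
    intro s hs
    rw [hB, aeval_eq_sum_range, MvPolynomial.coeff_sum] at hs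
    obtain ⟨i, hi, hne⟩ := Finset.exists_ne_zero_of_sum_ne_zero hs
    rw [MvPolynomial.coeff_smul] at hne
    have h1 := bounds_pow hWb i (right_ne_zero_of_smul hne)
    have hi' : i ≤ δ := by
      have := Finset.mem_range.1 hi
      omega
    rw [hp, hq]
    exact ⟨h1.1.trans (Nat.mul_le_mul_right _ hi'), h1.2.trans (Nat.mul_le_mul_right _ hi')⟩
  have hWtop : Chart.DegLE (toChart 0 W) p ∧ ((toChart 0 W).coeff p).natDegree = q ∧
      ((toChart 0 W).coeff p).Monic := by
    have h2 : ((toChart 0 W).coeff p).natDegree = q :=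
      natDegree_toChart (by decide : (0 : Fin 2) ≠ 1) (fun s hs _ => (hWb s hs).2) (by
        change MvPolynomial.coeff (expo p q) W ≠ 0
        rw [hWR.2]; exact one_ne_zero)
    refine ⟨degLE_toChart (by decide : (0 : Fin 2) ≠ 1) fun s hs => (hWb s hs).1, h2, ?_⟩
    rw [Monic, leadingCoeff, h2, coeff_toChart (by decide : (0 : Fin 2) ≠ 1)]
    exact hWR.2
  have hB1 : MvPolynomial.coeff (expo (m / a) (n / a)) B = 1 := by
    have h1 := (Chart.aeval_leading hWtop.1 (by exact_mod_cast hp0) hβ.1).2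
    rw [aeval_algHom_apply, ← hB, hβδ, ← Nat.cast_mul, ← hp] at h1
    have h2 := coeff_toChart (by decide : (0 : Fin 2) ≠ 1) B (m / a) (n / a)
    rw [h1] at h2
    rw [expo, ← h2]
    have h3 : ((toChart 0 W).coeff p ^ δ).natDegree = n / a := by
      rw [hWtop.2.2.natDegree_pow, hWtop.2.1, hq]
    rw [← h3]
    exact (hWtop.2.2.pow δ).coeff_natDegree
  have hQB : Q = B := by
    refine eq_of_pow_sub_pow ha (fun s hs => le_of_newton0_subset hQR.1.le hs) hBb hQR.2 hB1 ?_
    intro s hs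
    have h1 : MvPolynomial.coeff s (F - B ^ a) ≠ 0 ∨ MvPolynomial.coeff s (F - Q ^ a) ≠ 0 := by
      by_contra! hcon
      apply hs
      rw [show Q ^ a - B ^ a = (F - B ^ a) - (F - Q ^ a) by ring, MvPolynomial.coeff_sub, hcon.1,
        hcon.2, sub_zero]
    rcases h1 with h1 | h1
    · exact (bounds_of_supp_subset ha ham han hF.1.le hβsupp h1).2
    · exact (bounds_of_supp_subset ha ham han hF.1.le hQsupp h1).2
  -- The powers of `W` subtracted from `F - Q ^ a` have no monomial in the upper right corner either.
  have hZb : ∀ s, MvPolynomial.coeff s Z ≠ 0 → (s 0 ≤ m ∧ s 1 ≤ n) ∧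
      ¬ ((a - 1) * (m / a) ≤ s 0 ∧ (a - 1) * (n / a) ≤ s 1) := by
    intro s hs
    by_cases h1 : MvPolynomial.coeff s (F - Q ^ a) = 0
    · rw [hZeq, MvPolynomial.coeff_sub, h1, zero_sub, neg_ne_zero, MvPolynomial.coeff_sum] at hs
      obtain ⟨i, hi, hne⟩ := Finset.exists_ne_zero_of_sum_ne_zero hs
      rw [MvPolynomial.coeff_C_mul] at hne
      have h2 := bounds_pow hWb i (right_ne_zero_of_mul hne)
      have hi' : i < (a - 1) * δ := Finset.mem_range.1 hi
      have h3 : s 0 < (a - 1) * (δ * p) := by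
        rw [← mul_assoc]
        exact h2.1.trans_lt (Nat.mul_lt_mul_of_pos_right hi' hp0)
      have h4 : s 1 < (a - 1) * (δ * q) := by
        rw [← mul_assoc]
        exact h2.2.trans_lt (Nat.mul_lt_mul_of_pos_right hi' hq0)
      have h5 : (a - 1) * (δ * p) ≤ m := hm_eq ▸ Nat.mul_le_mul_right _ (Nat.sub_le _ _)
      have h6 : (a - 1) * (δ * q) ≤ n := hn_eq ▸ Nat.mul_le_mul_right _ (Nat.sub_le _ _)
      rw [hp, hq]
      omega
    · exact bounds_of_supp_subset ha ham han hF.1.le hQsupp h1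
  have hout : ∀ s, MvPolynomial.coeff s Z ≠ 0 →
      ¬ (((a : ℤ) - 1) * m ≤ a * s 0 ∧ ((a : ℤ) - 1) * n ≤ a * s 1) := by
    rintro s hs ⟨h1, h2⟩
    have ha' : (0 : ℤ) < a := by exact_mod_cast ha
    refine (hZb s hs).2 ⟨?_, ?_⟩
    · rw [hp]
      zify
      rw [Nat.cast_sub ha]
      rw [hm_eq] at h1
      push_cast at h1 ⊢
      exact le_of_mul_le_mul_left (by linarith) ha'
    · rw [hq]
      zify
      rw [Nat.cast_sub ha]
      rw [hn_eq] at h2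
      push_cast at h2 ⊢
      exact le_of_mul_le_mul_left (by linarith) ha'
  -- Hence `F = P(W) + Z` with `P = β ^ a + ∑ e_j z ^ j`.
  have hN : (a - 1) * δ ≤ a * β.natDegree := by
    rw [hβδ]; exact Nat.mul_le_mul_right _ (Nat.sub_le _ _)
  obtain ⟨hPm, hPd⟩ := monic_outer (a := a) hβ.1 hN e
  rw [hβδ] at hPd
  have hFeq : F = aeval W (β ^ a + ∑ j ∈ Finset.range ((a - 1) * δ),
      Polynomial.C (e j) * X ^ j) + Z := by
    rw [map_add, map_pow, ← hB, ← hQB, map_sum, hZeq]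
    have : ∀ j, aeval W (Polynomial.C (e j) * X ^ j) = MvPolynomial.C (e j) * W ^ j := by
      intro j
      rw [map_mul, aeval_C, map_pow, aeval_X]
      rfl
    simp only [this]
    ring
  obtain ⟨m₁, n₁, hne₁, hEN⟩ := exists_EN hZ0
  obtain ⟨m₂, n₂, hne₂, hNE⟩ := exists_NE hZ0
  have he0 : ∀ i j : ℕ, expo i j 0 = i := by intro i j; simp [expo]
  have he1 : ∀ i j : ℕ, expo i j 1 = j := by intro i j; simp [expo]
  have hb₁ := hZb _ hne₁
  have hb₂ := hZb _ hne₂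
  have hEN₂ := hEN _ hne₂
  have hNE₁ := hNE _ hne₁
  have ho₁ := hout _ hne₁
  have ho₂ := hout _ hne₂
  simp only [he0, he1] at hb₁ hb₂ hEN₂ hNE₁ ho₁ ho₂
  have hsm : ((a : ℤ) - 1) = ((a - 1 : ℕ) : ℤ) := by omega
  have hGm : a * (b * m / a) = b * m := Nat.mul_div_cancel' (ham.mul_left b)
  have hGn : a * (b * n / a) = b * n := Nat.mul_div_cancel' (han.mul_left b)
  have hdp : a * δ * p = m := by rw [hm_eq, mul_assoc]
  have hdq : a * δ * q = n := by rw [hn_eq, mul_assoc]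
  have hdp' : ((a * δ : ℕ) : ℤ) * p = m := by exact_mod_cast hdp
  have hdq' : ((a * δ : ℕ) : ℤ) * q = n := by exact_mod_cast hdq
  have hcomm : ∀ i j : ℕ, (Finsupp.single 1 j + Finsupp.single 0 i : Fin 2 →₀ ℕ) = expo i j :=
    fun i j => add_comm _ _
  have hENkey : (a : ℤ) * n₁ < (a - 1) * n → (n₁ : ℤ) * m < n * m₁ →
      ((a : ℤ) + b) * (n * m₁ - n₁ * m) ≤ a * ((n - n₁) - (m - m₁)) := by
    intro h1 h2
    by_contra! h3
    rw [hsm] at h1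
    refine false_of_vertex (i := 0) (j := 1) (by decide) (b := b) (g := b * m / a) hgcd ⟨δ, rfl⟩ hPm hPd
      hFeq hWb (by
        change MvPolynomial.coeff (expo p q) W ≠ 0
        rw [hWR.2]; exact one_ne_zero)
      (fun s hs => (le_of_newton0_subset hG.1.le hs).1) (by
        change MvPolynomial.coeff (expo _ _) G ≠ 0
        rw [hG.2]; exact one_ne_zero)
      (by rw [hGm, hdp]) hEN hne₁ hc (by rw [hdp]; omega) ?_ ?_ ?_
    · rw [hdq]; exact_mod_cast h1
    · rw [hdq, hdp]; exact_mod_cast h2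
    · rw [hdq', hdp']; exact h3
  have hNEkey : (a : ℤ) * m₂ < (a - 1) * m → (m₂ : ℤ) * n < m * n₂ →
      ((a : ℤ) + b) * (m * n₂ - m₂ * n) ≤ a * ((m - m₂) - (n - n₂)) := by
    intro h1 h2
    by_contra! h3
    rw [hsm] at h1
    refine false_of_vertex (i := 1) (j := 0) (by decide) (b := b) (g := b * n / a)
      (g' := b * m / a) (p := q) (μ := p) (D := n₂) (N := m₂) (c := -c) hgcd ⟨δ, rfl⟩ hPm hPd
      hFeq (fun s hs => (hWb s hs).symm) (by
        rw [hcomm, hWR.2]; exact one_ne_zero)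
      (fun s hs => (le_of_newton0_subset hG.1.le hs).2) (by
        rw [hcomm, hG.2]; exact one_ne_zero)
      (by rw [hGn, hdq]) hNE (by rw [hcomm]; exact hne₂) ?_ (by rw [hdq]; omega) ?_ ?_ ?_
    · rw [map_neg, ← hc, jacobian]; ring
    · rw [hdp]; exact_mod_cast h1
    · rw [hdq, hdp]; exact_mod_cast h2
    · rw [hdq', hdp']; exact h3
  obtain ⟨rm, rn, hsmall, hline, hdiag⟩ := vertices_coincide (a := a) (b := b) (m := m) (n := n)
    (m₁ := m₁) (n₁ := n₁) (m₂ := m₂) (n₂ := n₂) (by omega) (by omega) (by omega) (by omega)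
    (by omega) (by omega) (by omega) (by omega) (by omega) (by omega) (by omega) (by omega)
    ho₁ ho₂ hENkey hNEkey
  have rm' : m₁ = m₂ := by omega
  have rn' : n₁ = n₂ := by omega
  subst rm' rn'
  have ha1 : (1 : ℤ) ≤ a := by omega
  have hm1 : 0 < m₁ := by
    rcases Nat.eq_zero_or_pos m₁ with h0 | h0
    · exfalso
      subst h0
      have h1 : n₁ = 0 := by
        have : (m : ℤ) * n₁ ≤ 0 := by simpa using hdiag
        have hm' : (0 : ℤ) < m := by exact_mod_cast hm
        have : (n₁ : ℤ) ≤ 0 := by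
          by_contra! h
          have := mul_pos hm' h
          linarith
        omega
      subst h1
      have h2 := hZdiag 0 (Nat.mul_pos (by omega) hδ)
      simp only [zero_mul, Nat.zero_div] at h2
      exact hne₁ h2
    · exact h0
  have hn1 : 0 < n₁ := by
    rcases Nat.eq_zero_or_pos n₁ with h0 | h0
    · exfalso
      subst h0
      have hm1' : (1 : ℤ) ≤ m₁ := by exact_mod_cast hm1
      have hn' : (1 : ℤ) ≤ n := by exact_mod_cast hn
      have hm' : (1 : ℤ) ≤ m := by exact_mod_cast hm
      have hb' : (0 : ℤ) < b := by exact_mod_cast hb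
      have h1 : (0 : ℤ) < b * (n * m₁) := by positivity
      have h2 : (0 : ℤ) ≤ a * ((n - 1) * (m₁ - 1) + (m - 1)) := by
        apply mul_nonneg (by omega)
        have := mul_nonneg (show (0 : ℤ) ≤ n - 1 by omega) (show (0 : ℤ) ≤ m₁ - 1 by omega)
        omega
      push_cast at hline
      linarith
    · exact h0
  refine ⟨m₁, n₁, hm1, hn1, ⟨newton0_subset fun s hs => ⟨(hEN s hs).1, (hNE s hs).1⟩, hne₁⟩,
    mem_narrowRegion ha hb hm hsmall hline hdiag⟩

end PlaneJac

end

theorem theorem5 (a b m n : ℕ) (hQ : PlaneJac.Admissible a b m n) (hmn : m ≤ n)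
    (F G : PlaneJac.Poly) (hF : F ∈ PlaneJac.R m n)
    (hG : G ∈ PlaneJac.R (b * m / a) (b * n / a))
    (hFG : ∃ c : ℂ, PlaneJac.jacobian F G = MvPolynomial.C c)
    (Z : PlaneJac.Poly) (hZ : PlaneJac.IsInnermost a m n F Z) :
    (Z = 0 ∨ ∃ m' n' : ℕ, 0 < m' ∧ 0 < n' ∧ Z ∈ PlaneJac.Rbar m' n' ∧
        ((m' : ℝ), (n' : ℝ)) ∈ PlaneJac.narrowRegion a b m n) ∧
      ∃ v : ℝ × ℝ, PlaneJac.IsNEVertex (PlaneJac.newton0 Z) v ∧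
        PlaneJac.IsENVertex (PlaneJac.newton0 Z) v := by
  rcases eq_or_ne Z 0 with rfl | hZ0
  · refine ⟨Or.inl rfl, (0, 0), ?_⟩
    rw [PlaneJac.newton0_zero, PlaneJac.IsNEVertex, PlaneJac.IsENVertex, extremePoints_singleton]
    simp
  · have h := PlaneJac.innermost_mem_narrowRegion hQ hmn hF hG hFG hZ hZ0
    refine ⟨Or.inr h, ?_⟩
    obtain ⟨m', n', -, -, hR, -⟩ := h
    exact ⟨_, PlaneJac.vertices_of_newton0 hR⟩
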